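/- **Conventions.** A trivalent graph $G$ is a finite graph (loops and multiple edges allowed) in which exactly three half-edges emanate from every vertex; it is *oriented* if at every vertex a cyclic ordering of the three half-edges is chosen. "Connected" includes non-empty, and $G$ is *2-connected* if it is connected and remains connected after the removal of any single edge. Let $v$ be the number of vertices of $G$ (it is even). For a finite dimensional Lie algebra $L$ with an ad-invariant symmetric non-degenerate bilinear form $\langle\cdot,\cdot\rangle$ and a basis $(L_a)$, let $t_{ab}=\langle L_a,L_b\rangle$, let $(t^{ab})$ be the inverse matrix, and let $f_{abc}=\langle L_a,[L_b,L_c]\rangle$. For an oriented trivalent graph $G$, the number $W_L(G)$ is the sum, over all labellings of the half-edges of $G$ by basis indices, of the product over the vertices of the constants $f_{abc}$ (where $a,b,c$ are the labels read in cyclic order around the vertex) times the product over the edges of the constants $t^{ab}$ (where $a,b$ are the labels of the two halves of the edge). It does not depend on the basis. For $N\ge 1$, $sl(N)$ is the Lie algebra of traceless complex $N\times N$ matrices with $\langle x,y\rangle=\operatorname{tr}(xy)$. Embeddings in an oriented sphere are described combinatorially. A choice of a cyclic ordering at every vertex of a connected trivalent graph $G$ determines a closed oriented surface: thicken $G$ according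 to the cyclic orderings and glue a disk into each boundary component of the thickening. It is an *embedding of $G$ in an oriented sphere* if this surface has Euler characteristic $v-e+f=2$, where $e$ is the number of edges and $f$ the number of disks. The disks are then the states of the *map* $G^c$; two different states are adjacent if they lie on the two sides of some edge of $G$. (The cyclic orderings of an embedding are unrelated to the orientation of $G$ that is used in $W_L(G)$.) **Theorem.** 1. For every connected oriented trivalent graph $G$ with $v$ vertices, $W_{sl(N)}(G)$, $N\ge 1$, is a polynomial in $N$ of degree at most $\frac v2+2$. Let $W^{\mathrm{top}}_{sl(N)}(G)$ denote the coefficient of $N^{\frac v2+2}$ in this polynomial. 2. The following two assertions are equivalent: (a) for every connected oriented trivalent graph $G$, $W_{sl(2)}(G)=0$ implies $W^{\mathrm{top}}_{sl(N)}(G)=0$; (b) (the Four Color Theorem) for every 2-connected trivalent graph $G$ and every embedding of $G$ in an oriented sphere, the states of the map $G^c$ can be colored with four colors so that adjacent states have different colors. -/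

import Mathlib

open scoped Polynomial

/-! ## Trivalent graphs -/

/-- A finite trivalent graph, loops and multiple edges allowed, given by its half-edges.  Each
half-edge `h` emanates from the vertex `vertexOf h`, and `opp h` is the other half of the edge that
contains `h`.  Exactly three half-edges emanate from each vertex. -/
structure TrivalentGraph where
  Vertex : Type
  HalfEdge : Type
  [fintypeVertex : Fintype Vertex]
  [fintypeHalfEdge : Fintype HalfEdge]
  vertexOf : HalfEdge → Vertex
  opp : Equiv.Perm HalfEdge
  opp_opp : ∀ h, opp (opp h) = h
  opp_ne : ∀ h, opp h ≠ h
  trivalent : ∀ v, Nat.card {h : HalfEdge // vertexOf h = v} = 3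

namespace TrivalentGraph

attribute [instance] TrivalentGraph.fintypeVertex TrivalentGraph.fintypeHalfEdge

/-- An edge is a pair `{h, opp h}` of half-edges, that is, an orbit of `opp`. -/
def Edge (G : TrivalentGraph) : Type :=
  Quotient (Equiv.Perm.SameCycle.setoid G.opp)

noncomputable instance (G : TrivalentGraph) : Fintype G.Edge :=
  @Fintype.ofFinite _ (inferInstanceAs (Finite (Quotient (Equiv.Perm.SameCycle.setoid G.opp))))

/-- One of the two halves of an edge; the other one is `G.opp (G.halfOf e)`. -/
noncomputable def halfOf (G : TrivalentGraph) (e : G.Edge) : G.HalfEdge :=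
  Quotient.out e

theorem exists_halfEdge (G : TrivalentGraph) (v : G.Vertex) : ∃ h, G.vertexOf h = v := by
  have h3 := G.trivalent v
  have : Nonempty {h : G.HalfEdge // G.vertexOf h = v} := by
    by_contra hne
    rw [not_nonempty_iff] at hne
    rw [Nat.card_of_isEmpty] at h3
    omega
  exact ⟨this.some.1, this.some.2⟩

/-- One of the three half-edges that emanate from a vertex. -/
noncomputable def halfAt (G : TrivalentGraph) (v : G.Vertex) : G.HalfEdge :=
  (G.exists_halfEdge v).choose

/-- `G` is nonempty and any two vertices are joined by a path. -/
def Connected (G : TrivalentGraph) : Prop :=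
  Nonempty G.Vertex ∧ ∀ u v : G.Vertex,
    Relation.ReflTransGen (fun a b => ∃ h, G.vertexOf h = a ∧ G.vertexOf (G.opp h) = b) u v

/-- `G` is connected, and stays connected when any single edge `{e, opp e}` is removed. -/
def TwoConnected (G : TrivalentGraph) : Prop :=
  G.Connected ∧ ∀ (e : G.HalfEdge) (u v : G.Vertex),
    Relation.ReflTransGen
      (fun a b => ∃ h, h ≠ e ∧ h ≠ G.opp e ∧ G.vertexOf h = a ∧ G.vertexOf (G.opp h) = b) u v

/-- A choice, at every vertex, of a cyclic ordering of the half-edges that emanate from it: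
`next h` is the half-edge that follows `h` around its vertex.  The orbits of `next` are exactly the
sets of half-edges that emanate from a common vertex. -/
structure CyclicOrder (G : TrivalentGraph) where
  next : Equiv.Perm G.HalfEdge
  sameCycle_iff : ∀ h k, next.SameCycle h k ↔ G.vertexOf h = G.vertexOf k

end TrivalentGraph

/-! ## Metrized Lie algebras and the functionals `W_L` -/

/-- An ad-invariant symmetric nondegenerate bilinear form on a Lie algebra. -/
structure LieMetric (K L : Type*) [Field K] [LieRing L] [LieAlgebra K L] where
  form : LinearMap.BilinForm K L
  symm : ∀ x y, form x y = form y x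
  invariant : ∀ x y z, form ⁅x, y⁆ z = form x ⁅y, z⁆
  nondegenerate : form.Nondegenerate

namespace LieMetric

variable {K L ι : Type*} [Field K] [LieRing L] [LieAlgebra K L]

/-- The structure constants `f_{abc} = ⟨L_a, [L_b, L_c]⟩` relative to a basis `(L_a)`. -/
noncomputable def structureConstant (M : LieMetric K L) (B : Module.Basis ι K L) (a b c : ι) : K :=
  M.form (B a) ⁅B b, B c⁆

theorem structureConstant_cyclic (M : LieMetric K L) (B : Module.Basis ι K L) (a b c : ι) :
    M.structureConstant B a b c = M.structureConstant B b c a := by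
  unfold structureConstant
  rw [M.symm, M.invariant]

open Classical in
/-- The inverse `(t^{ab})` of the matrix `t_{ab} = ⟨L_a, L_b⟩`. -/
noncomputable def inverseMetric [Fintype ι] (M : LieMetric K L) (B : Module.Basis ι K L) :
    Matrix ι ι K :=
  (LinearMap.BilinForm.toMatrix B M.form)⁻¹

open Classical in
/-- The number `W_L(G)` computed in the basis `B`: the sum, over all labellings `ℓ` of the half-edges
of `G` by basis indices, of the product over the vertices of the structure constants seen in cyclic
order around them, times the product over the edges of the entries of the inverse metric seen on
them.  By the cyclic symmetry of the structure constants and the symmetry of the inverse metric, the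
half-edge `G.halfAt v` at which the reading of `v` starts and the order of the two halves of an edge
are immaterial. -/
noncomputable def weightInBasis [Fintype ι] (M : LieMetric K L) (B : Module.Basis ι K L)
    (G : TrivalentGraph) (o : G.CyclicOrder) : K :=
  ∑ ℓ : G.HalfEdge → ι,
    (∏ v : G.Vertex, M.structureConstant B
      (ℓ (G.halfAt v)) (ℓ (o.next (G.halfAt v))) (ℓ (o.next (o.next (G.halfAt v))))) *
    ∏ e : G.Edge, M.inverseMetric B (ℓ (G.halfOf e)) (ℓ (G.opp (G.halfOf e)))

/-- The number `W_L(G)` (some basis of `L` is chosen; the value does not depend on it). -/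
noncomputable def weight [FiniteDimensional K L] (M : LieMetric K L)
    (G : TrivalentGraph) (o : G.CyclicOrder) : K :=
  M.weightInBasis (Module.finBasis K L) G o

end LieMetric

/-! ## The Lie algebras `sl(N)` -/

/-- The complex Lie algebra of traceless `N × N` matrices. -/
abbrev SlLie (N : ℕ) : Type := LieAlgebra.SpecialLinear.sl (Fin N) ℂ

/-- The bilinear form `⟨x, y⟩ = tr (x y)` on `sl(N)`. -/
noncomputable def slForm (N : ℕ) : LinearMap.BilinForm ℂ (SlLie N) :=
  LinearMap.mk₂ ℂ (fun x y => Matrix.trace (x.val * y.val))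
    (fun x x' y => by simp [add_mul])
    (fun c x y => by simp)
    (fun x y y' => by simp [mul_add])
    (fun c x y => by simp)

theorem slForm_apply (N : ℕ) (x y : SlLie N) : slForm N x y = Matrix.trace (x.val * y.val) := rfl

theorem slForm_symm (N : ℕ) (x y : SlLie N) : slForm N x y = slForm N y x := by
  rw [slForm_apply, slForm_apply, Matrix.trace_mul_comm]

theorem slForm_separating (N : ℕ) (x : SlLie N) (hx : ∀ y, slForm N x y = 0) : x = 0 := by
  have hoff : ∀ i j : Fin N, i ≠ j → x.val i j = 0 := by
    intro i j hij
    have h := hx (LieAlgebra.SpecialLinear.single j i hij.symm 1)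
    rw [slForm_apply] at h
    simpa [Matrix.trace_mul_single] using h
  have hdiag : ∀ i j : Fin N, x.val i i = x.val j j := by
    intro i j
    have h := hx (LieAlgebra.SpecialLinear.singleSubSingle i j 1)
    rw [slForm_apply, LieAlgebra.SpecialLinear.val_singleSubSingle] at h
    simp [mul_sub, Matrix.trace_mul_single] at h
    exact sub_eq_zero.mp h
  have htr : Matrix.trace x.val = 0 := by
    have h := x.2
    simpa [LieAlgebra.SpecialLinear.sl] using h
  apply Subtype.ext
  ext i j
  by_cases hij : i = j
  · subst hij
    have hN : (N : ℂ) ≠ 0 := by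
      have : 0 < N := i.pos
      exact_mod_cast this.ne'
    have : (N : ℂ) * x.val i i = 0 := by
      rw [← htr, Matrix.trace]
      simp [Matrix.diag, fun k => hdiag k i]
    simpa [hN] using this
  · simpa using hoff i j hij

/-- The matrix trace metric on `sl(N)`. -/
noncomputable def slMetric (N : ℕ) : LieMetric ℂ (SlLie N) where
  form := slForm N
  symm := slForm_symm N
  invariant x y z := by
    simp only [slForm_apply, LieAlgebra.SpecialLinear.sl_bracket, sub_mul, mul_sub,
      Matrix.trace_sub, Matrix.mul_assoc]
    rw [Matrix.trace_mul_comm y.val (x.val * z.val), Matrix.mul_assoc]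
  nondegenerate :=
    ⟨fun x hx => slForm_separating N x hx,
      fun y hy => slForm_separating N y fun x => by rw [slForm_symm, hy]⟩

namespace TrivalentGraph

variable {G : TrivalentGraph}

/-- The number `W_{sl(N)}(G)`. -/
noncomputable def CyclicOrder.slWeight (o : G.CyclicOrder) (N : ℕ) : ℂ :=
  (slMetric N).weight G o

/-- `P` expresses `W_{sl(N)}(G)` as a polynomial in `N`; there is at most one such `P`. -/
def CyclicOrder.IsSlPolynomial (o : G.CyclicOrder) (P : ℂ[X]) : Prop :=
  ∀ N : ℕ, 1 ≤ N → P.eval (N : ℂ) = o.slWeight N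

open Classical in
/-- The number `W_{sl(N)}^{top}(G)`: the coefficient of `N ^ (v / 2 + 2)` in `W_{sl(N)}(G)`, viewed as
a polynomial in `N`, where `v` is the number of vertices of `G` (which is even). -/
noncomputable def CyclicOrder.slTop (o : G.CyclicOrder) : ℂ :=
  if h : ∃ P, o.IsSlPolynomial P then h.choose.coeff (Fintype.card G.Vertex / 2 + 2) else 0

/-! ## Embeddings in the sphere and the maps they define -/

/-- Walking along the half-edge `h` to the other end of its edge and turning there into the next
half-edge in the cyclic order. -/
def CyclicOrder.faceStep (o : G.CyclicOrder) : Equiv.Perm G.HalfEdge :=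
  G.opp.trans o.next

/-- The faces of the closed oriented surface that is obtained by thickening `G` according to the
cyclic order and gluing a disk into each boundary component: they are the orbits of the walk around
the boundary. -/
def CyclicOrder.Face (o : G.CyclicOrder) : Type :=
  Quotient (Equiv.Perm.SameCycle.setoid o.faceStep)

noncomputable instance (o : G.CyclicOrder) : Fintype o.Face :=
  @Fintype.ofFinite _ (inferInstanceAs (Finite (Quotient (Equiv.Perm.SameCycle.setoid o.faceStep))))

/-- The face on a given side of an edge.  The two sides of the edge `{h, opp h}` lie in the faces
`o.faceOf h` and `o.faceOf (G.opp h)`. -/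
def CyclicOrder.faceOf (o : G.CyclicOrder) (h : G.HalfEdge) : o.Face :=
  Quotient.mk _ h

/-- The cyclic order defines an embedding of the connected graph `G` in an oriented sphere: the closed
surface it defines has Euler characteristic `v - e + f = 2`. -/
def CyclicOrder.IsSpherical (o : G.CyclicOrder) : Prop :=
  G.Connected ∧
    (Fintype.card G.Vertex : ℤ) - Fintype.card G.Edge + Fintype.card o.Face = 2

/-- The adjacency graph of the map `G^c` whose states are the faces: two different states are adjacent
when they lie on the two sides of some edge of `G`. -/
def CyclicOrder.mapGraph (o : G.CyclicOrder) : SimpleGraph o.Face where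
  Adj a b := a ≠ b ∧ ∃ h, a = o.faceOf h ∧ b = o.faceOf (G.opp h)
  symm := ⟨by
    rintro a b ⟨hab, h, ha, hb⟩
    exact ⟨hab.symm, G.opp h, hb, by rw [G.opp_opp]; exact ha⟩⟩
  loopless := ⟨fun a h => h.1 rfl⟩

end TrivalentGraph

/-! `W_{sl(N)}` counts surfaces, `W_{sl(2)}` counts edge colorings, and on the sphere neither count
can cancel.

For `sl(N)`, the Casimir tensor is represented by the traceless parts of the elementary matrices,
`E_ij` paired with `E_ji`. A vertex then contributes `tr(ABC) - tr(ACB)`, the difference of its two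
cyclic orders. Expanding gives one term `(-1)^|S| N^F` for every set `S` of reversed vertices, with
`F` the number of faces (`eval_facePolynomial`). Euler's inequality (`card_face_le`) says `F ≤ v/2 +
2`, with equality exactly on the sphere, so the top coefficient is a signed count of spherical
embeddings. If `G` has a bridge, reversing one side of it preserves `F` and changes the sign, so
everything cancels (`facePolynomial_eq_zero`). If `G` is 2-connected, two spherical embeddings
differ at an even number of vertices (`IsSpherical.even_card`), so the top coefficient is nonzero as
soon as one embedding exists.

For `sl(2)`, the Pauli matrices turn the weight into a nonzero multiple of the signed number of Tait
colorings (`slWeight_two`). On the sphere all of these have the same sign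
(`IsSpherical.prod_sign_eq`), so the weight vanishes only if there are none. By Tait's argument they
are the differences, across the edges, of four-colorings of the faces. Thus for 2-connected planar
`G` the top coefficient is nonzero, and `W_{sl(2)}(G)` is nonzero exactly when the map is
four-colorable; for all other connected `G` the top coefficient is zero. -/

namespace TrivalentGraph

variable {G : TrivalentGraph}

/-! ### Half-edges around a vertex -/

namespace CyclicOrder

theorem vertexOf_next (o : G.CyclicOrder) (h : G.HalfEdge) :
    G.vertexOf (o.next h) = G.vertexOf h :=
  ((o.sameCycle_iff _ _).1 (Equiv.Perm.sameCycle_apply_left.2 (Equiv.Perm.SameCycle.refl _ _)))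

theorem minimalPeriod_next (o : G.CyclicOrder) (h : G.HalfEdge) :
    Function.minimalPeriod o.next h = 3 := by
  classical
  have h1 := MulAction.minimalPeriod_eq_card (a := o.next) (b := h)
  have h2 := G.trivalent (G.vertexOf h)
  change Function.minimalPeriod o.next h = _ at h1
  rw [h1, ← h2, ← Nat.card_eq_fintype_card]
  refine Nat.card_congr (Equiv.subtypeEquivRight fun k => ?_)
  -- The orbit of `h` under `next` is its whole vertex, which has three half-edges.
  rw [eq_comm, ← o.sameCycle_iff, MulAction.mem_orbit_iff]
  constructor
  · rintro ⟨⟨g, i, rfl⟩, rfl⟩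
    exact ⟨i, rfl⟩
  · rintro ⟨i, rfl⟩
    exact ⟨⟨_, i, rfl⟩, rfl⟩

@[simp]
theorem next_next_next (o : G.CyclicOrder) (h : G.HalfEdge) :
    o.next (o.next (o.next h)) = h := by
  have h1 := Function.iterate_minimalPeriod (f := o.next) (x := h)
  rwa [minimalPeriod_next] at h1

theorem next_ne (o : G.CyclicOrder) (h : G.HalfEdge) : o.next h ≠ h := fun h1 => by
  have h2 : Function.minimalPeriod o.next h ∣ 1 :=
    Function.IsPeriodicPt.minimalPeriod_dvd (by simpa [Function.IsPeriodicPt, Function.IsFixedPt])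
  rw [minimalPeriod_next] at h2
  omega

theorem next_next_ne (o : G.CyclicOrder) (h : G.HalfEdge) : o.next (o.next h) ≠ h := fun h1 =>
  o.next_ne h (by conv_rhs => rw [← o.next_next_next h, h1])

open Classical in
theorem filter_vertexOf (o : G.CyclicOrder) (h : G.HalfEdge) :
    (Finset.univ.filter fun k => G.vertexOf k = G.vertexOf h) =
      {h, o.next h, o.next (o.next h)} := by
  symm
  apply Finset.eq_of_subset_of_card_le
  · intro k hk
    simp only [Finset.mem_insert, Finset.mem_singleton] at hk
    rcases hk with rfl | rfl | rfl <;> simp [vertexOf_next]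
  · have h2 := G.trivalent (G.vertexOf h)
    rw [Nat.card_eq_fintype_card, Fintype.card_subtype] at h2
    rw [h2, Finset.card_insert_of_notMem, Finset.card_insert_of_notMem, Finset.card_singleton]
    · simpa using (o.next_ne (o.next h)).symm
    · simp only [Finset.mem_insert, Finset.mem_singleton, not_or]
      exact ⟨(o.next_ne h).symm, (o.next_next_ne h).symm⟩

theorem vertexOf_eq_iff (o : G.CyclicOrder) (h k : G.HalfEdge) :
    G.vertexOf k = G.vertexOf h ↔ k = h ∨ k = o.next h ∨ k = o.next (o.next h) := by
  classical
  have := congrArg (k ∈ ·) (o.filter_vertexOf h)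
  simpa using this

open Classical in
theorem sum_vertexOf {M : Type*} [AddCommMonoid M] (o : G.CyclicOrder) (g : G.HalfEdge → M)
    (h : G.HalfEdge) :
    (∑ k with G.vertexOf k = G.vertexOf h, g k) =
      g h + (g (o.next h) + g (o.next (o.next h))) := by
  rw [o.filter_vertexOf, Finset.sum_insert, Finset.sum_insert, Finset.sum_singleton]
  · simpa using (o.next_ne (o.next h)).symm
  · simp only [Finset.mem_insert, Finset.mem_singleton, not_or]
    exact ⟨(o.next_ne h).symm, (o.next_next_ne h).symm⟩

theorem sum_halfEdge {M : Type*} [AddCommMonoid M] (o : G.CyclicOrder) (g : G.HalfEdge → M) :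
    ∑ h, g h = ∑ v, (g (G.halfAt v) + (g (o.next (G.halfAt v)) +
      g (o.next (o.next (G.halfAt v))))) := by
  classical
  rw [← Finset.sum_fiberwise_of_maps_to (g := G.vertexOf) (t := Finset.univ) (by simp)]
  refine Finset.sum_congr rfl fun v _ => ?_
  have hv : G.vertexOf (G.halfAt v) = v := (G.exists_halfEdge v).choose_spec
  rw [← o.sum_vertexOf, hv]

end CyclicOrder

theorem vertexOf_halfAt (v : G.Vertex) : G.vertexOf (G.halfAt v) = v :=
  (G.exists_halfEdge v).choose_spec

theorem card_halfEdge_eq_three_mul (G : TrivalentGraph) :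
    Fintype.card G.HalfEdge = 3 * Fintype.card G.Vertex := by
  classical
  rw [← Finset.card_univ, Finset.card_eq_sum_card_fiberwise (f := G.vertexOf)
    (t := Finset.univ) (by simp)]
  have (v : G.Vertex) : (Finset.univ.filter fun k => G.vertexOf k = v).card = 3 := by
    have h2 := G.trivalent v
    rwa [Nat.card_eq_fintype_card, Fintype.card_subtype] at h2
  simp [this, mul_comm]

/-! ### The two halves of an edge -/

theorem sameCycle_opp_iff (h k : G.HalfEdge) : G.opp.SameCycle h k ↔ k = h ∨ k = G.opp h := by
  constructor
  · rintro ⟨i, rfl⟩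
    have h2 : G.opp ^ (2 : ℤ) = 1 := by
      ext x
      simp [zpow_ofNat, pow_two, G.opp_opp]
    rcases Int.even_or_odd' i with ⟨j, rfl | rfl⟩
    · left; simp [zpow_mul, h2]
    · right; simp [zpow_add, zpow_mul, h2]
  · rintro (rfl | rfl)
    · exact Equiv.Perm.SameCycle.refl _ _
    · exact Equiv.Perm.sameCycle_apply_right.2 (Equiv.Perm.SameCycle.refl _ _)

/-- Half-edges are the same as edges together with one of their two halves. -/
noncomputable def edgeBoolEquiv (G : TrivalentGraph) : G.Edge × Bool ≃ G.HalfEdge :=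
  Equiv.ofBijective (fun p => if p.2 then G.opp (G.halfOf p.1) else G.halfOf p.1) <| by
    have key : ∀ (e : G.Edge) (b : Bool),
        (Quotient.mk _ (if b then G.opp (G.halfOf e) else G.halfOf e) : G.Edge) = e := by
      intro e b
      conv_rhs => rw [← Quotient.out_eq e]
      apply Quotient.sound
      change G.opp.SameCycle _ _
      rw [sameCycle_opp_iff]
      cases b
      · left; rfl
      · right
        simp only [if_true, G.opp_opp]
        rfl
    constructor
    · rintro ⟨e, b⟩ ⟨e', b'⟩ h
      have h1 : e = e' := by
        rw [← key e b, ← key e' b']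
        exact congrArg _ h
      subst h1
      cases b <;> cases b' <;> simp_all [G.opp_ne, (G.opp_ne _).symm]
    · intro h
      have h1 : G.opp.SameCycle (G.halfOf (Quotient.mk _ h)) h :=
        Quotient.mk_out (s := Equiv.Perm.SameCycle.setoid G.opp) h
      rcases (sameCycle_opp_iff _ _).1 h1 with h2 | h2
      · exact ⟨(Quotient.mk _ h, false), by simpa using h2.symm⟩
      · exact ⟨(Quotient.mk _ h, true), by simpa using h2.symm⟩

@[simp] theorem edgeBoolEquiv_false (e : G.Edge) : G.edgeBoolEquiv (e, false) = G.halfOf e := rfl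

@[simp] theorem edgeBoolEquiv_true (e : G.Edge) :
    G.edgeBoolEquiv (e, true) = G.opp (G.halfOf e) := rfl

theorem exists_edge_of_halfEdge (h : G.HalfEdge) :
    ∃ e, h = G.halfOf e ∨ h = G.opp (G.halfOf e) := by
  obtain ⟨⟨e, b⟩, rfl⟩ := G.edgeBoolEquiv.surjective h
  cases b
  · exact ⟨e, Or.inl rfl⟩
  · exact ⟨e, Or.inr rfl⟩

theorem sum_halfEdge_eq_sum_edge {M : Type*} [AddCommMonoid M] (g : G.HalfEdge → M) :
    ∑ h, g h = ∑ e, (g (G.halfOf e) + g (G.opp (G.halfOf e))) := by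
  rw [← G.edgeBoolEquiv.sum_comp, Fintype.sum_prod_type]
  simp [add_comm]

theorem card_halfEdge_eq_two_mul (G : TrivalentGraph) :
    Fintype.card G.HalfEdge = 2 * Fintype.card G.Edge := by
  rw [← Fintype.card_congr G.edgeBoolEquiv, Fintype.card_prod, Fintype.card_bool, mul_comm]

/-! ### Reversing a cyclic order at some vertices -/

namespace CyclicOrder

open Classical in
/-- The rotation around the vertices, reversed at the vertices of `S`. -/
noncomputable def flipNext (o : G.CyclicOrder) (S : Finset G.Vertex) : Equiv.Perm G.HalfEdge where
  toFun h := if G.vertexOf h ∈ S then o.next (o.next h) else o.next h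
  invFun h := if G.vertexOf h ∈ S then o.next h else o.next (o.next h)
  left_inv h := by by_cases hS : G.vertexOf h ∈ S <;> simp [hS, vertexOf_next]
  right_inv h := by by_cases hS : G.vertexOf h ∈ S <;> simp [hS, vertexOf_next]

open Classical in
/-- The cyclic order that is reversed at the vertices of `S`. -/
noncomputable def flip (o : G.CyclicOrder) (S : Finset G.Vertex) : G.CyclicOrder where
  next := o.flipNext S
  sameCycle_iff h k := by
    set p := o.flipNext S
    have hp : ∀ h, p h = if G.vertexOf h ∈ S then o.next (o.next h) else o.next h := fun _ => rfl
    have hpv : ∀ h, G.vertexOf (p h) = G.vertexOf h := fun h => by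
      rw [hp]; split_ifs <;> simp [vertexOf_next]
    have hr := Equiv.Perm.SameCycle.refl p h
    constructor
    · intro hk
      obtain ⟨i, rfl⟩ := hk.exists_nat_pow_eq
      induction i with
      | zero => simp
      | succ i ih =>
        rw [pow_succ', Equiv.Perm.mul_apply, hpv]
        exact ih ⟨i, by simp⟩
    · intro hk
      rcases (o.vertexOf_eq_iff h k).1 hk.symm with rfl | rfl | rfl
      · exact hr
      · by_cases hS : G.vertexOf h ∈ S
        · have : p (p h) = o.next h := by simp [hp, hS, vertexOf_next]
          rw [← this]
          exact Equiv.Perm.sameCycle_apply_right.2 (Equiv.Perm.sameCycle_apply_right.2 hr)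
        · have : p h = o.next h := by simp [hp, hS]
          rw [← this]
          exact Equiv.Perm.sameCycle_apply_right.2 hr
      · by_cases hS : G.vertexOf h ∈ S
        · have : p h = o.next (o.next h) := by simp [hp, hS]
          rw [← this]
          exact Equiv.Perm.sameCycle_apply_right.2 hr
        · have : p (p h) = o.next (o.next h) := by simp [hp, hS, vertexOf_next]
          rw [← this]
          exact Equiv.Perm.sameCycle_apply_right.2 (Equiv.Perm.sameCycle_apply_right.2 hr)

theorem flip_next_of_mem (o : G.CyclicOrder) {S : Finset G.Vertex} {h : G.HalfEdge}
    (hS : G.vertexOf h ∈ S) : (o.flip S).next h = o.next (o.next h) := by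
  classical
  exact if_pos hS

theorem flip_next_of_notMem (o : G.CyclicOrder) {S : Finset G.Vertex} {h : G.HalfEdge}
    (hS : G.vertexOf h ∉ S) : (o.flip S).next h = o.next h := by
  classical
  exact if_neg hS

@[ext]
theorem ext {o o' : G.CyclicOrder} (h : ∀ k, o.next k = o'.next k) : o = o' := by
  cases o; cases o'
  congr
  exact Equiv.ext h

open Classical in
theorem flip_flip (o : G.CyclicOrder) (S T : Finset G.Vertex) :
    (o.flip S).flip T = o.flip (symmDiff S T) := by
  ext h
  by_cases hS : G.vertexOf h ∈ S <;> by_cases hT : G.vertexOf h ∈ T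
  · rw [flip_next_of_mem _ hT, flip_next_of_mem _ hS, flip_next_of_mem,
      flip_next_of_notMem]
    · simp
    · simp [Finset.mem_symmDiff, hS, hT]
    · simpa [vertexOf_next] using hS
  · rw [flip_next_of_notMem _ hT, flip_next_of_mem _ hS, flip_next_of_mem]
    simp [Finset.mem_symmDiff, hS, hT]
  · rw [flip_next_of_mem _ hT, flip_next_of_notMem _ hS, flip_next_of_notMem,
      flip_next_of_mem]
    · simp [Finset.mem_symmDiff, hS, hT]
    · simpa [vertexOf_next] using hS
  · rw [flip_next_of_notMem _ hT, flip_next_of_notMem _ hS, flip_next_of_notMem]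
    simp [Finset.mem_symmDiff, hS, hT]

@[simp]
theorem flip_empty (o : G.CyclicOrder) : o.flip ∅ = o := by
  ext h
  exact o.flip_next_of_notMem (by simp)

/-! ### Potentials: functions on the faces -/

/-- `n` is constant along the boundary of every face. -/
def IsPotential {X : Type*} (o : G.CyclicOrder) (n : G.HalfEdge → X) : Prop :=
  ∀ h, n (G.opp h) = n (o.next h)

theorem IsPotential.apply_eq {X : Type*} {o : G.CyclicOrder} {n : G.HalfEdge → X}
    (hn : o.IsPotential n) {h k : G.HalfEdge} (hk : o.faceStep.SameCycle h k) : n h = n k := by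
  obtain ⟨i, rfl⟩ := hk.exists_nat_pow_eq
  clear hk
  induction i with
  | zero => simp
  | succ i ih =>
    rw [ih, pow_succ', Equiv.Perm.mul_apply]
    change _ = n (o.next (G.opp _))
    rw [← hn, G.opp_opp]

theorem faceOf_next (o : G.CyclicOrder) (h : G.HalfEdge) :
    o.faceOf (o.next h) = o.faceOf (G.opp h) := by
  apply Quotient.sound
  change o.faceStep.SameCycle _ _
  have : o.next h = o.faceStep (G.opp h) := by
    change _ = o.next (G.opp (G.opp h)); rw [G.opp_opp]
  rw [this]
  exact Equiv.Perm.sameCycle_apply_left.2 (Equiv.Perm.SameCycle.refl _ _)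

/-- Potentials are the same as functions on the set of faces. -/
def potentialEquiv (o : G.CyclicOrder) (X : Type*) :
    {n : G.HalfEdge → X // o.IsPotential n} ≃ (o.Face → X) where
  toFun n := Quotient.lift n.1 fun _ _ hk => n.2.apply_eq hk
  invFun g := ⟨fun h => g (o.faceOf h), fun h => congrArg g (o.faceOf_next h).symm⟩
  left_inv n := rfl
  right_inv g := by
    ext f
    induction f using Quotient.inductionOn
    rfl

theorem isPotential_comp_faceOf {X : Type*} (o : G.CyclicOrder) (g : o.Face → X) :
    o.IsPotential fun h => g (o.faceOf h) :=
  ((o.potentialEquiv X).symm g).2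

/-- Counting potentials detects the number of faces: `X = Fin N` produces the power `N ^ F`, and `X
= Bool` compares the face numbers of two cyclic orders. -/
theorem card_potential (o : G.CyclicOrder) (X : Type*) [Fintype X] :
    Nat.card {n : G.HalfEdge → X // o.IsPotential n} =
      Fintype.card X ^ Fintype.card o.Face := by
  rw [Nat.card_congr (o.potentialEquiv X), Nat.card_fun, Nat.card_eq_fintype_card,
    Nat.card_eq_fintype_card]

end CyclicOrder

end TrivalentGraph

namespace TrivalentGraph

variable {G : TrivalentGraph}

/-! ### Flows, and Euler's inequality -/

theorem Connected.eq_of_forall {X : Type*} (hG : G.Connected) {x : G.Vertex → X}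
    (hx : ∀ h, x (G.vertexOf h) = x (G.vertexOf (G.opp h))) (u v : G.Vertex) : x u = x v := by
  induction hG.2 u v with
  | refl => rfl
  | tail _ h ih =>
    obtain ⟨k, rfl, rfl⟩ := h
    rw [ih, hx]

open Classical in
/-- The `K`-valued flows on `G`: antisymmetric functions on the half-edges whose sum at every vertex
is zero. -/
noncomputable def flows (G : TrivalentGraph) (K : Type*) [Field K] :
    Submodule K (G.HalfEdge → K) where
  carrier := {c | (∀ h, c (G.opp h) = -c h) ∧ ∀ v, ∑ h with G.vertexOf h = v, c h = 0}
  zero_mem' := by simp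
  add_mem' := fun {c d} hc hd => by
    refine ⟨fun h => ?_, fun v => ?_⟩
    · rw [Pi.add_apply, Pi.add_apply, hc.1, hd.1]; ring
    · simp [Finset.sum_add_distrib, hc.2, hd.2]
  smul_mem' := fun r {c} hc => by
    refine ⟨fun h => ?_, fun v => ?_⟩
    · simp [hc.1]
    · simp [← Finset.mul_sum, hc.2]

theorem opp_eq_neg_of_mem_flows {K : Type*} [Field K] {c : G.HalfEdge → K} (hc : c ∈ G.flows K)
    (h : G.HalfEdge) : c (G.opp h) = -c h := hc.1 h

theorem CyclicOrder.mem_flows_iff {K : Type*} [Field K] (o : G.CyclicOrder) {c : G.HalfEdge → K} :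
    c ∈ G.flows K ↔ (∀ h, c (G.opp h) = -c h) ∧
      ∀ h, c h + (c (o.next h) + c (o.next (o.next h))) = 0 := by
  classical
  refine and_congr_right fun _ => ⟨fun H h => ?_, fun H v => ?_⟩
  · rw [← o.sum_vertexOf]; exact H _
  · rw [← vertexOf_halfAt v, o.sum_vertexOf, H]

open Classical in
/-- The vertex-edge incidence matrix. -/
noncomputable def incidence (G : TrivalentGraph) (K : Type*) [Field K] : Matrix G.Vertex G.Edge K :=
  fun v e => (if G.vertexOf (G.halfOf e) = v then 1 else 0) -
    (if G.vertexOf (G.opp (G.halfOf e)) = v then 1 else 0)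

/-- The kernel of the transposed incidence matrix consists of functions that agree at the ends of
every edge, hence of constants. -/
theorem Connected.card_vertex_le_rank_incidence (hG : G.Connected) (K : Type*) [Field K] :
    Fintype.card G.Vertex ≤ (G.incidence K).rank + 1 := by
  classical
  rw [← Matrix.rank_transpose, Matrix.rank]
  have h1 := LinearMap.finrank_range_add_finrank_ker (G.incidence K).transpose.mulVecLin
  rw [Module.finrank_fintype_fun_eq_card] at h1
  have h2 : Module.finrank K (LinearMap.ker (G.incidence K).transpose.mulVecLin) ≤ 1 := by
    have hone : (fun _ => 1 : G.Vertex → K) ∈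
        LinearMap.ker (G.incidence K).transpose.mulVecLin := by
      ext e
      simp [Matrix.vecMul, dotProduct, incidence]
    refine finrank_le_one ⟨_, hone⟩ ?_
    rintro ⟨x, hx⟩
    obtain ⟨v₀⟩ := hG.1
    refine ⟨x v₀, Subtype.ext (funext fun v => ?_)⟩
    suffices x v₀ = x v by simpa using this
    refine hG.eq_of_forall (fun h => ?_) _ _
    obtain ⟨e, he⟩ := exists_edge_of_halfEdge h
    have h3 := congrFun (LinearMap.mem_ker.1 hx) e
    have h4 : x (G.vertexOf (G.halfOf e)) - x (G.vertexOf (G.opp (G.halfOf e))) = 0 := by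
      simpa [Matrix.vecMul, dotProduct, incidence, mul_sub, Finset.sum_sub_distrib] using h3
    rcases he with rfl | rfl
    · exact sub_eq_zero.1 h4
    · rw [G.opp_opp]; exact (sub_eq_zero.1 h4).symm
  omega

/-- An antisymmetric function is determined by one half of each edge, and there the vertex condition
is the kernel equation of the incidence matrix. -/
theorem finrank_flows_add_rank_le (G : TrivalentGraph) (K : Type*) [Field K] :
    Module.finrank K (G.flows K) + (G.incidence K).rank ≤ Fintype.card G.Edge := by
  classical
  have h1 := LinearMap.finrank_range_add_finrank_ker (G.incidence K).mulVecLin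
  rw [Module.finrank_fintype_fun_eq_card] at h1
  have hmem : ∀ c ∈ G.flows K, LinearMap.funLeft K K G.halfOf c ∈
      LinearMap.ker (G.incidence K).mulVecLin := by
    intro c hc
    ext v
    have h2 := hc.2 v
    rw [Finset.sum_filter, sum_halfEdge_eq_sum_edge] at h2
    simp only [Matrix.mulVecLin_apply, Matrix.mulVec, dotProduct, incidence, Pi.zero_apply,
      LinearMap.funLeft_apply]
    refine Eq.trans ?_ h2
    refine Finset.sum_congr rfl fun e _ => ?_
    rw [opp_eq_neg_of_mem_flows hc]
    split_ifs <;> ring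
  have h2 : Module.finrank K (G.flows K) ≤
      Module.finrank K (LinearMap.ker (G.incidence K).mulVecLin) := by
    refine LinearMap.finrank_le_finrank_of_injective
      (f := (LinearMap.funLeft K K G.halfOf).restrict hmem) ?_
    rw [injective_iff_map_eq_zero]
    rintro ⟨c, hc⟩ h
    have h3 : ∀ e, c (G.halfOf e) = 0 := fun e => congrFun (congrArg Subtype.val h) e
    refine Subtype.ext (funext fun k => ?_)
    obtain ⟨e, rfl | rfl⟩ := exists_edge_of_halfEdge k
    · exact h3 e
    · change c _ = 0
      rw [opp_eq_neg_of_mem_flows hc, h3, neg_zero]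
  rw [Matrix.rank]
  omega

/-- The bound is the first Betti number `e - v + 1`, rewritten by `3v = 2e`. -/
theorem Connected.finrank_flows_le (hG : G.Connected) (K : Type*) [Field K] :
    Module.finrank K (G.flows K) ≤ Fintype.card G.Vertex / 2 + 1 := by
  have h1 := hG.card_vertex_le_rank_incidence K
  have h2 := G.finrank_flows_add_rank_le K
  have h3 := G.card_halfEdge_eq_three_mul
  have h4 := G.card_halfEdge_eq_two_mul
  omega

namespace CyclicOrder

/-- The flow around the faces that is defined by a function on the set of faces. -/
noncomputable def faceFlow (o : G.CyclicOrder) (K : Type*) [Field K] :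
    (o.Face → K) →ₗ[K] G.flows K where
  toFun g := ⟨fun h => g (o.faceOf h) - g (o.faceOf (G.opp h)), by
    rw [o.mem_flows_iff]
    refine ⟨fun h => by rw [G.opp_opp]; ring, fun h => ?_⟩
    -- The flow on `h` is the difference of `g` at `h` and `next h`, so the sum around a vertex
    -- telescopes.
    simp only [← faceOf_next, next_next_next]
    ring⟩
  map_add' g g' := by
    ext h
    simp only [Pi.add_apply, Submodule.coe_add]
    ring
  map_smul' r g := by
    ext h
    simp only [Pi.smul_apply, smul_eq_mul, RingHom.id_apply, Submodule.coe_smul]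
    ring

/-- If the flow vanishes, `g` does not change across an edge, hence not around a vertex, hence
nowhere by connectedness. -/
theorem finrank_ker_faceFlow_le (o : G.CyclicOrder) (hG : G.Connected) (K : Type*) [Field K] :
    Module.finrank K (LinearMap.ker (o.faceFlow K)) ≤ 1 := by
  have hone : (fun _ => 1 : o.Face → K) ∈ LinearMap.ker (o.faceFlow K) := by
    ext h
    simp [faceFlow]
  refine finrank_le_one ⟨_, hone⟩ ?_
  rintro ⟨g, hg⟩
  obtain ⟨v₀⟩ := hG.1
  refine ⟨g (o.faceOf (G.halfAt v₀)), Subtype.ext (funext fun f => ?_)⟩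
  have h1 : ∀ h, g (o.faceOf h) = g (o.faceOf (G.opp h)) := fun h =>
    sub_eq_zero.1 (congrFun (congrArg Subtype.val hg) h)
  have h2 : ∀ h k, G.vertexOf h = G.vertexOf k → g (o.faceOf h) = g (o.faceOf k) := by
    have h3 : ∀ h, g (o.faceOf (o.next h)) = g (o.faceOf h) := fun h => by
      rw [faceOf_next, ← h1]
    intro h k hk
    rcases (o.vertexOf_eq_iff k h).1 hk with rfl | rfl | rfl <;> simp only [h3]
  have h4 := hG.eq_of_forall (x := fun v => g (o.faceOf (G.halfAt v))) (fun h => by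
    rw [h2 _ h (vertexOf_halfAt _), h2 _ (G.opp h) (vertexOf_halfAt _), h1])
  induction f using Quotient.inductionOn with | h h => ?_
  have h5 : g (o.faceOf (G.halfAt v₀)) = g (o.faceOf h) := by
    rw [h4 _ (G.vertexOf h), h2 _ h (vertexOf_halfAt _)]
  exact (mul_one _).trans h5

/-- Euler's inequality. -/
theorem card_face_le (o : G.CyclicOrder) (hG : G.Connected) :
    Fintype.card o.Face ≤ Fintype.card G.Vertex / 2 + 2 := by
  -- Face flows span a space of dimension at least `F - 1` inside the flows, which have dimension at
  -- most `v/2 + 1`.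
  have h1 := LinearMap.finrank_range_add_finrank_ker (o.faceFlow ℚ)
  have h2 := o.finrank_ker_faceFlow_le hG ℚ
  have h3 := Submodule.finrank_le (LinearMap.range (o.faceFlow ℚ))
  have h4 := hG.finrank_flows_le ℚ
  rw [Module.finrank_fintype_fun_eq_card] at h1
  omega

/-- By `3v = 2e`, the sphere is the case of equality in Euler's inequality, which is what the top
degree sees. -/
theorem isSpherical_iff (o : G.CyclicOrder) (hG : G.Connected) :
    o.IsSpherical ↔ Fintype.card o.Face = Fintype.card G.Vertex / 2 + 2 := by
  have h3 := G.card_halfEdge_eq_three_mul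
  have h4 := G.card_halfEdge_eq_two_mul
  rw [IsSpherical, and_iff_right hG]
  omega

/-- On the sphere every flow runs around the faces. -/
theorem IsSpherical.exists_potential {o : G.CyclicOrder} (ho : o.IsSpherical) {K : Type*} [Field K]
    {c : G.HalfEdge → K} (hc : c ∈ G.flows K) :
    ∃ g : o.Face → K, ∀ h, c h = g (o.faceOf h) - g (o.faceOf (G.opp h)) := by
  have h0 := (o.isSpherical_iff ho.1).1 ho
  have h1 := LinearMap.finrank_range_add_finrank_ker (o.faceFlow K)
  have h2 := o.finrank_ker_faceFlow_le ho.1 K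
  have h4 := ho.1.finrank_flows_le K
  rw [Module.finrank_fintype_fun_eq_card] at h1
  have h3 := Submodule.finrank_le (LinearMap.range (o.faceFlow K))
  -- Equality in Euler's inequality leaves no room for flows outside the range.
  have h5 : LinearMap.range (o.faceFlow K) = ⊤ :=
    Submodule.eq_top_of_finrank_eq (by omega)
  obtain ⟨g, hg⟩ := LinearMap.range_eq_top.1 h5 ⟨c, hc⟩
  exact ⟨g, fun h => (congrFun (congrArg Subtype.val hg) h).symm⟩

end CyclicOrder

/-! ### Faces of a bridgeless spherical map -/

/-- A path that returns from the far end of `k` to its start without using `k` closes up with `k` to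
a cycle. The induction builds a unit flow along the path, with source `vertexOf (opp k)` and sink
its current end. -/
theorem exists_flow_of_twoConnected (hG : G.TwoConnected) (k : G.HalfEdge) :
    ∃ c ∈ G.flows ℚ, c k = 1 := by
  classical
  obtain ⟨c, hk, hopp, hsum⟩ : ∃ c : G.HalfEdge → ℚ, c k = 0 ∧ (∀ h, c (G.opp h) = -c h) ∧
      ∀ v, ∑ h with G.vertexOf h = v, c h =
        (if G.vertexOf (G.opp k) = v then 1 else 0) - (if G.vertexOf k = v then 1 else 0) := by
    have hpath := hG.2 k (G.vertexOf (G.opp k)) (G.vertexOf k)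
    generalize G.vertexOf k = w at hpath
    induction hpath with
    | refl => exact ⟨0, by simp⟩
    | tail _ h ih =>
      obtain ⟨a, ha, ha', rfl, rfl⟩ := h
      obtain ⟨c, hk, hopp, hsum⟩ := ih
      refine ⟨c + Pi.single a 1 - Pi.single (G.opp a) 1, ?_, fun h => ?_, fun v => ?_⟩
      · have : k ≠ G.opp a := fun h => ha' (by rw [h, G.opp_opp])
        simp [hk, ha.symm, this]
      · have h1 : G.opp h = a ↔ h = G.opp a :=
          ⟨fun h => by rw [← h, G.opp_opp], fun h => by rw [h, G.opp_opp]⟩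
        simp only [Pi.sub_apply, Pi.add_apply, hopp, Pi.single_apply, h1,
          EmbeddingLike.apply_eq_iff_eq]
        ring
      · simp only [Pi.sub_apply, Pi.add_apply, Finset.sum_sub_distrib, Finset.sum_add_distrib,
          hsum, Finset.sum_pi_single', Finset.mem_filter, Finset.mem_univ, true_and]
        ring
  refine ⟨c + Pi.single k 1 - Pi.single (G.opp k) 1, ⟨fun h => ?_, fun v => ?_⟩, ?_⟩
  · have h1 : G.opp h = k ↔ h = G.opp k :=
      ⟨fun h => by rw [← h, G.opp_opp], fun h => by rw [h, G.opp_opp]⟩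
    simp only [Pi.sub_apply, Pi.add_apply, hopp, Pi.single_apply, h1,
      EmbeddingLike.apply_eq_iff_eq]
    ring
  · simp only [Pi.sub_apply, Pi.add_apply, Finset.sum_sub_distrib, Finset.sum_add_distrib,
      hsum, Finset.sum_pi_single', Finset.mem_filter, Finset.mem_univ, true_and]
    ring
  · simp [hk, (G.opp_ne k).symm]

/-- A flow that is nonzero on `h` is the difference of a potential across `h`, so the two sides
cannot coincide. -/
theorem CyclicOrder.IsSpherical.faceOf_opp_ne {o : G.CyclicOrder} (ho : o.IsSpherical)
    (hG : G.TwoConnected) (h : G.HalfEdge) : o.faceOf (G.opp h) ≠ o.faceOf h := by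
  intro h1
  obtain ⟨c, hc, hch⟩ := exists_flow_of_twoConnected hG h
  obtain ⟨g, hg⟩ := ho.exists_potential hc
  rw [hg, h1, sub_self] at hch
  exact zero_ne_one hch

end TrivalentGraph

namespace TrivalentGraph

variable {G : TrivalentGraph}

/-! ### Bridges -/

/-- The edge of `k` is the only edge between `A` and its complement. -/
structure IsBridgeOf (k : G.HalfEdge) (A : Finset G.Vertex) : Prop where
  mem : G.vertexOf k ∈ A
  opp_notMem : G.vertexOf (G.opp k) ∉ A
  mem_iff : ∀ h, h ≠ k → h ≠ G.opp k → (G.vertexOf h ∈ A ↔ G.vertexOf (G.opp h) ∈ A)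

theorem Connected.exists_bridge (hG : G.Connected) (h2 : ¬G.TwoConnected) :
    ∃ (k : G.HalfEdge) (A : Finset G.Vertex), IsBridgeOf k A := by
  classical
  have h3 : ∃ (e : G.HalfEdge) (u v : G.Vertex), ¬Relation.ReflTransGen
      (fun a b => ∃ h, h ≠ e ∧ h ≠ G.opp e ∧ G.vertexOf h = a ∧ G.vertexOf (G.opp h) = b) u v := by
    by_contra! h3
    exact h2 ⟨hG, h3⟩
  obtain ⟨e, u, v, huv⟩ := h3
  set r := Relation.ReflTransGen
      (fun a b => ∃ h, h ≠ e ∧ h ≠ G.opp e ∧ G.vertexOf h = a ∧ G.vertexOf (G.opp h) = b)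
  let A : Finset G.Vertex := Finset.univ.filter fun w => r u w
  have hA : ∀ w, w ∈ A ↔ r u w := by simp [A]
  have hstep : ∀ h, h ≠ e → h ≠ G.opp e → G.vertexOf h ∈ A → G.vertexOf (G.opp h) ∈ A := by
    intro h h1 h2 h3
    rw [hA] at h3 ⊢
    exact h3.tail ⟨h, h1, h2, rfl, rfl⟩
  have hiff : ∀ h, h ≠ e → h ≠ G.opp e → (G.vertexOf h ∈ A ↔ G.vertexOf (G.opp h) ∈ A) := by
    intro h h1 h2
    refine ⟨hstep h h1 h2, fun h3 => ?_⟩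
    rw [← G.opp_opp h]
    refine hstep _ (fun h4 => h2 ?_) (fun h4 => h1 (G.opp.injective h4)) h3
    rw [← h4, G.opp_opp]
  -- If both ends of `e` lay on the same side, the set `A` of vertices reachable from `u` would be a
  -- union of components of `G` and would contain `v`.
  by_cases h4 : G.vertexOf e ∈ A ↔ G.vertexOf (G.opp e) ∈ A
  · have h5 : ∀ h, G.vertexOf h ∈ A ↔ G.vertexOf (G.opp h) ∈ A := by
      intro h
      by_cases h6 : h = e
      · rw [h6, h4]
      by_cases h7 : h = G.opp e
      · rw [h7, G.opp_opp, h4]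
      exact hiff h h6 h7
    have h6 := hG.eq_of_forall (x := fun w => w ∈ A) (fun h => propext (h5 h)) u v
    exact absurd ((hA v).1 (h6.mp ((hA u).2 Relation.ReflTransGen.refl))) huv
  · by_cases h5 : G.vertexOf e ∈ A
    · exact ⟨e, A, h5, fun h6 => h4 (iff_of_true h5 h6), hiff⟩
    · have h6 : G.vertexOf (G.opp e) ∈ A := by
        by_contra h6
        exact h4 (iff_of_false h5 h6)
      refine ⟨G.opp e, A, h6, by rwa [G.opp_opp], fun h h7 h8 => hiff h ?_ h7⟩
      rwa [G.opp_opp] at h8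

namespace IsBridgeOf

variable {k : G.HalfEdge} {A : Finset G.Vertex}

-- The two halves of an edge inside `A` cancel; only the bridge survives.
open Classical in
theorem sum_eq {R : Type*} [AddCommGroup R] (hk : IsBridgeOf k A) {c : G.HalfEdge → R}
    (hc : ∀ h, c (G.opp h) = -c h) : ∑ v ∈ A, ∑ h with G.vertexOf h = v, c h = c k := by
  have h1 : ∑ v ∈ A, ∑ h with G.vertexOf h = v, c h = ∑ h with G.vertexOf h ∈ A, c h := by
    rw [← Finset.sum_fiberwise_of_maps_to (s := Finset.univ.filter fun h => G.vertexOf h ∈ A)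
      (t := A) (g := G.vertexOf) (by simp)]
    refine Finset.sum_congr rfl fun v hv => Finset.sum_congr ?_ fun _ _ => rfl
    ext h
    simp only [Finset.mem_filter, Finset.mem_univ, true_and]
    exact ⟨fun h => ⟨h ▸ hv, h⟩, And.right⟩
  rw [h1, ← Finset.add_sum_erase _ _ (show k ∈ Finset.univ.filter fun h => G.vertexOf h ∈ A by
    simpa using hk.mem), add_eq_left]
  refine Finset.sum_involution (fun h _ => G.opp h) (fun h _ => by rw [hc]; simp)
    (fun h _ _ => G.opp_ne h) (fun h hh => ?_) (fun h _ => G.opp_opp h)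
  simp only [Finset.mem_erase, Finset.mem_filter, Finset.mem_univ, true_and] at hh ⊢
  have h2 : h ≠ G.opp k := fun h3 => hk.opp_notMem (h3 ▸ hh.2)
  exact ⟨fun h3 => h2 (by rw [← h3, G.opp_opp]), (hk.mem_iff h hh.1 h2).1 hh.2⟩

/-- Modulo 2 the constant function 1 is antisymmetric and sums to `3 = 1` at every vertex. -/
theorem odd_card (hk : IsBridgeOf k A) : Odd A.card := by
  classical
  have h1 := hk.sum_eq (R := ZMod 2) (c := fun _ => 1) (fun _ => by decide)
  have h2 : ∀ v, ∑ h with G.vertexOf h = v, (1 : ZMod 2) = 1 := by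
    intro v
    rw [Finset.sum_const, ← Fintype.card_subtype, ← Nat.card_eq_fintype_card, G.trivalent]
    decide
  simp only [h2, Finset.sum_const, nsmul_eq_mul, mul_one] at h1
  exact (ZMod.natCast_eq_one_iff_odd).1 h1

/-- The two sides of a bridge lie in the same face. -/
theorem faceOf_opp (hk : IsBridgeOf k A) (o : G.CyclicOrder) :
    o.faceOf (G.opp k) = o.faceOf k := by
  classical
  by_contra hne
  -- Flows vanish on a bridge, but the flow around the face of `k` would be 1 there if the other
  -- side were a different face.
  let c := o.faceFlow ℚ (Pi.single (o.faceOf k) 1)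
  have h1 := hk.sum_eq c.2.1
  rw [Finset.sum_eq_zero fun v _ => c.2.2 v] at h1
  have h2 : c.1 k = 1 := by simp [c, CyclicOrder.faceFlow, hne]
  rw [h2] at h1
  exact zero_ne_one h1

/-- Reversing one side of a bridge transforms potentials into potentials. -/
theorem exists_potential_flip (hk : IsBridgeOf k A) (o : G.CyclicOrder) {X : Type*}
    {n : G.HalfEdge → X} (hn : o.IsPotential n) :
    (o.flip A).IsPotential
      (fun h => open Classical in if G.vertexOf h ∈ A then n (o.next h) else n h) := by
  classical
  -- Reversal exchanges the two sides of the half-edges in `A`, so `n h` becomes `n (opp h) = n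
  -- (next h)`. Across the bridge this is consistent because both its sides carry the same value.
  have hbr : n k = n (G.opp k) :=
    ((o.potentialEquiv X).symm_apply_apply ⟨n, hn⟩ ▸
      congrArg ((o.potentialEquiv X) ⟨n, hn⟩) (hk.faceOf_opp o)).symm
  intro h
  simp only [CyclicOrder.vertexOf_next]
  by_cases h1 : h = k
  · subst h1
    rw [if_neg hk.opp_notMem, if_pos hk.mem, o.flip_next_of_mem hk.mem, o.next_next_next, hbr]
  by_cases h2 : h = G.opp k
  · subst h2
    rw [if_neg hk.opp_notMem, o.flip_next_of_notMem hk.opp_notMem, G.opp_opp, if_pos hk.mem,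
      ← hn, ← hn, G.opp_opp, hbr]
  have h3 := hk.mem_iff h h1 h2
  by_cases h4 : G.vertexOf h ∈ A
  · rw [if_pos (h3.1 h4), if_pos h4, o.flip_next_of_mem h4, o.next_next_next, ← hn, G.opp_opp]
  · rw [if_neg (fun h5 => h4 (h3.2 h5)), if_neg h4, o.flip_next_of_notMem h4, hn]

theorem card_face_le_flip (hk : IsBridgeOf k A) (o : G.CyclicOrder) :
    Fintype.card o.Face ≤ Fintype.card (o.flip A).Face := by
  classical
  rw [← Nat.pow_le_pow_iff_right (a := 2) (by norm_num)]
  have h1 := o.card_potential Bool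
  have h2 := (o.flip A).card_potential Bool
  rw [Fintype.card_bool] at h1 h2
  rw [← h1, ← h2]
  refine Nat.card_le_card_of_injective (fun n => ⟨_, hk.exists_potential_flip o n.2⟩) ?_
  rintro ⟨n, hn⟩ ⟨n', hn'⟩ h
  have h3 : ∀ h, (if G.vertexOf h ∈ A then n (o.next h) else n h) =
    (if G.vertexOf h ∈ A then n' (o.next h) else n' h) := fun k =>
    congrFun (congrArg Subtype.val h) k
  refine Subtype.ext (funext fun h => ?_)
  by_cases h4 : G.vertexOf h ∈ A
  · have h5 := h3 (o.next (o.next h))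
    simpa [CyclicOrder.vertexOf_next, h4] using h5
  · simpa [h4] using h3 h

theorem card_face_flip (hk : IsBridgeOf k A) (o : G.CyclicOrder) :
    Fintype.card (o.flip A).Face = Fintype.card o.Face := by
  classical
  refine le_antisymm ?_ (hk.card_face_le_flip o)
  have h1 := hk.card_face_le_flip (o.flip A)
  rwa [o.flip_flip, symmDiff_self, Finset.bot_eq_empty, o.flip_empty] at h1

end IsBridgeOf

/-! ### The polynomial `W_{sl(N)}(G)` -/

namespace CyclicOrder

/-- The signed sum, over all cyclic orders, of the monomials that count their faces. -/
noncomputable def facePolynomial (o : G.CyclicOrder) : ℂ[X] :=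
  ∑ S : Finset G.Vertex, (-1) ^ S.card * Polynomial.X ^ Fintype.card (o.flip S).Face

theorem natDegree_facePolynomial_le (o : G.CyclicOrder) (hG : G.Connected) :
    o.facePolynomial.natDegree ≤ Fintype.card G.Vertex / 2 + 2 := by
  refine Polynomial.natDegree_sum_le_of_forall_le _ _ fun S _ => ?_
  have h1 : ((-1 : ℂ[X]) ^ S.card) = Polynomial.C ((-1) ^ S.card) := by simp
  rw [h1]
  exact (Polynomial.natDegree_C_mul_X_pow_le _ _).trans ((o.flip S).card_face_le hG)

open Classical in
theorem coeff_facePolynomial (o : G.CyclicOrder) (hG : G.Connected) :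
    o.facePolynomial.coeff (Fintype.card G.Vertex / 2 + 2) =
      ∑ S : Finset G.Vertex, if (o.flip S).IsSpherical then (-1) ^ S.card else 0 := by
  rw [facePolynomial, Polynomial.finsetSum_coeff]
  refine Finset.sum_congr rfl fun S _ => ?_
  have h1 : ((-1 : ℂ[X]) ^ S.card) = Polynomial.C ((-1) ^ S.card) := by simp
  rw [h1, Polynomial.coeff_C_mul_X_pow, isSpherical_iff _ hG]
  split_ifs <;> first | rfl | omega

/-- The involution `S ↦ symmDiff S A`, with `A` one side of a bridge, preserves the number of faces
and changes the sign because `A` is odd. -/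
theorem facePolynomial_eq_zero (o : G.CyclicOrder) (hG : G.Connected) (h2 : ¬G.TwoConnected) :
    o.facePolynomial = 0 := by
  classical
  obtain ⟨k, A, hk⟩ := hG.exists_bridge h2
  have hinv : Function.Involutive fun S : Finset G.Vertex => symmDiff S A := fun S => by
    simp
  have h1 : o.facePolynomial = -o.facePolynomial := by
    conv_lhs => rw [facePolynomial, ← Equiv.sum_comp hinv.toPerm]
    rw [facePolynomial, ← Finset.sum_neg_distrib]
    refine Finset.sum_congr rfl fun S _ => ?_
    change (-1) ^ (symmDiff S A).card * _ ^ Fintype.card (o.flip (symmDiff S A)).Face = _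
    rw [← o.flip_flip, hk.card_face_flip, ← neg_mul]
    congr 1
    have h3 : (symmDiff S A).card + 2 * (S ∩ A).card = S.card + A.card := by
      have h5 := Finset.card_sdiff_add_card_inter S A
      have h6 := Finset.card_sdiff_add_card_inter A S
      rw [symmDiff_def, Finset.sup_eq_union, Finset.card_union_of_disjoint disjoint_sdiff_sdiff]
      rw [Finset.inter_comm] at h6
      omega
    have h4 : ((-1 : ℂ[X]) ^ (symmDiff S A).card) =
        (-1) ^ ((symmDiff S A).card + 2 * (S ∩ A).card) := by
      rw [pow_add, pow_mul]; simp
    rw [h4, h3, pow_add, hk.odd_card.neg_one_pow]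
    ring
  exact self_eq_neg.1 h1

end CyclicOrder

end TrivalentGraph

namespace TrivalentGraph

variable {G : TrivalentGraph}

/-! ### Two spherical maps differ at an even number of vertices -/

namespace CyclicOrder

/-- The intersection form of the surface vanishes on the flows around the faces. -/
theorem sum_intersection_eq_zero (o : G.CyclicOrder) {K : Type*} [Field K] {g d : G.HalfEdge → K}
    (hg : o.IsPotential g) (hd : d ∈ G.flows K) :
    ∑ h, ((g h - g (G.opp h)) * d (o.next h) -
      (g (o.next h) - g (G.opp (o.next h))) * d h) = 0 := by
  have hs (F : G.HalfEdge → K) : ∑ h, F (o.next h) = ∑ h, F h := Equiv.sum_comp o.next F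
  have h1 : ∑ h, g (o.next h) * d (o.next h) = ∑ h, g h * d h := hs fun h => g h * d h
  have h2 : ∑ h, g (o.next (o.next h)) * d h = ∑ h, g h * d (o.next h) := by
    rw [← hs]
    simp
  have h3 : ∑ h, g h * d (o.next (o.next h)) = ∑ h, g (o.next h) * d h := by
    rw [← hs]
    simp
  have h4 : ∑ h, g h * d h + ∑ h, g h * d (o.next h) + ∑ h, g h * d (o.next (o.next h)) = 0 := by
    rw [← Finset.sum_add_distrib, ← Finset.sum_add_distrib]
    refine Finset.sum_eq_zero fun h _ => ?_
    rw [← mul_add, ← mul_add, add_assoc, (o.mem_flows_iff.1 hd).2, mul_zero]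
  have h5 : ∑ h, g (o.next h) * d h = -∑ h, g h * d h := by
    rw [← Equiv.sum_comp G.opp (fun h => g h * d h), ← Finset.sum_neg_distrib]
    refine Finset.sum_congr rfl fun h _ => ?_
    rw [← hg, opp_eq_neg_of_mem_flows hd]
    ring
  have h6 : ∑ h, ((g h - g (G.opp h)) * d (o.next h) -
      (g (o.next h) - g (G.opp (o.next h))) * d h) =
      ∑ h, g h * d (o.next h) - ∑ h, g (o.next h) * d (o.next h) - ∑ h, g (o.next h) * d h
        + ∑ h, g (o.next (o.next h)) * d h := by
    simp only [← Finset.sum_add_distrib, ← Finset.sum_sub_distrib]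
    refine Finset.sum_congr rfl fun h _ => ?_
    rw [hg, hg]
    ring
  -- With `P = ∑ g h * d h` and `Q = ∑ g h * d (next h)`, the expression reduces to `2Q`, while the
  -- vertex condition `h4` reduces to `Q = 0`.
  rw [h6]
  linear_combination -h1 + h2 + 2 * h4 - 2 * h3 - 3 * h5

theorem faceFlow_apply (o : G.CyclicOrder) {K : Type*} [Field K] (g : o.Face → K)
    (h : G.HalfEdge) : (o.faceFlow K g).1 h = g (o.faceOf h) - g (o.faceOf (o.next h)) := by
  rw [faceOf_next]; rfl

-- The intersection form vanishes on these flows for `o`, and also for `o.flip S`, because on the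
-- sphere every flow is a face flow. The difference of the two is supported on `S`.
open Classical in
theorem sum_mem_intersection_eq_zero (o : G.CyclicOrder) {S : Finset G.Vertex}
    (hS : (o.flip S).IsSpherical) (a b : o.Face → ℚ) :
    ∑ h with G.vertexOf h ∈ S, (a (o.faceOf h) * b (o.faceOf (o.next h)) -
      b (o.faceOf h) * a (o.faceOf (o.next h))) = 0 := by
  have hs (F : G.HalfEdge → ℚ) : ∑ h, F (o.next h) = ∑ h, F h := Equiv.sum_comp o.next F
  set c := o.faceFlow ℚ a with hc
  set d := o.faceFlow ℚ b with hd
  let T : G.HalfEdge → ℚ := fun h => c.1 h * d.1 (o.next h) - c.1 (o.next h) * d.1 h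
  let U : G.HalfEdge → ℚ := fun h => a (o.faceOf h) * b (o.faceOf (o.next h)) -
      b (o.faceOf h) * a (o.faceOf (o.next h))
  have hTU : ∀ h, T h = U h + U (o.next h) + U (o.next (o.next h)) := by
    intro h
    simp only [T, U, hc, hd, faceFlow_apply, next_next_next]
    ring
  have h1 : ∑ h, T h = 0 := o.sum_intersection_eq_zero (o.isPotential_comp_faceOf a) d.2
  -- This is the form of `o.flip S`: at a reversed vertex, `next` becomes `next ∘ next` and the term
  -- at `h` becomes `-T (next (next h))`.
  have h2 : ∑ h, (if G.vertexOf h ∈ S then -T (o.next (o.next h)) else T h) = 0 := by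
    obtain ⟨g, hg⟩ := hS.exists_potential c.2
    have h3 := (o.flip S).sum_intersection_eq_zero ((o.flip S).isPotential_comp_faceOf g) d.2
    rw [← h3]
    refine Finset.sum_congr rfl fun h _ => ?_
    rw [← hg, ← hg]
    split_ifs with hh
    · rw [flip_next_of_mem _ hh]
      simp only [T, next_next_next]
      ring
    · rw [flip_next_of_notMem _ hh]
  have hsS (F : G.HalfEdge → ℚ) : ∑ h, (if G.vertexOf h ∈ S then F (o.next h) else 0) =
      ∑ h, (if G.vertexOf h ∈ S then F h else 0) := by
    rw [← hs fun h => if G.vertexOf h ∈ S then F h else 0]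
    simp only [vertexOf_next]
  have h4 : ∑ h, (if G.vertexOf h ∈ S then T h else 0) = 0 := by
    have h5 : ∑ h, (if G.vertexOf h ∈ S then -T (o.next (o.next h)) else T h) =
        ∑ h, T h - ∑ h, (if G.vertexOf h ∈ S then T h else 0)
          - ∑ h, (if G.vertexOf h ∈ S then T (o.next (o.next h)) else 0) := by
      rw [← Finset.sum_sub_distrib, ← Finset.sum_sub_distrib]
      refine Finset.sum_congr rfl fun h _ => ?_
      split_ifs <;> ring
    rw [hsS fun h => T (o.next h), hsS, h1, h2] at h5
    linarith
  have h6 : ∑ h, (if G.vertexOf h ∈ S then T h else 0) =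
      ∑ h, (if G.vertexOf h ∈ S then U h else 0)
      + ∑ h, (if G.vertexOf h ∈ S then U (o.next h) else 0)
      + ∑ h, (if G.vertexOf h ∈ S then U (o.next (o.next h)) else 0) := by
    rw [← Finset.sum_add_distrib, ← Finset.sum_add_distrib]
    refine Finset.sum_congr rfl fun h _ => ?_
    rw [hTU]
    split_ifs <;> ring
  rw [hsS fun h => U (o.next h), hsS, h4] at h6
  rw [Finset.sum_filter]
  linarith

/-- Order the faces arbitrarily and let `σ h = ±1` compare the faces of `h` and `next h`, which
differ by 2-connectedness. Summing the previous identity over indicator functions of pairs of faces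
gives `∑ σ = 0` over the `3|S|` half-edges at `S`; modulo 2 every term is 1. -/
theorem IsSpherical.even_card {o : G.CyclicOrder} (ho : o.IsSpherical) (hG : G.TwoConnected)
    {S : Finset G.Vertex} (hS : (o.flip S).IsSpherical) : Even S.card := by
  classical
  let r := Fintype.equivFin o.Face
  let σ : G.HalfEdge → ℤ := fun h =>
    (if r (o.faceOf h) < r (o.faceOf (o.next h)) then 1 else 0) -
      (if r (o.faceOf (o.next h)) < r (o.faceOf h) then 1 else 0)
  have h1 : ∑ h with G.vertexOf h ∈ S, (σ h : ℚ) = 0 := by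
    have h2 : ∀ h, (σ h : ℚ) = ∑ i, ∑ j, if r i < r j then
        ((Pi.single i 1 : o.Face → ℚ) (o.faceOf h) *
          (Pi.single j 1 : o.Face → ℚ) (o.faceOf (o.next h)) -
        (Pi.single j 1 : o.Face → ℚ) (o.faceOf h) *
          (Pi.single i 1 : o.Face → ℚ) (o.faceOf (o.next h))) else 0 := by
      intro h
      have h3 : ∀ f f' : o.Face, (∑ i, ∑ j, if r i < r j then
          (Pi.single i 1 : o.Face → ℚ) f * (Pi.single j 1 : o.Face → ℚ) f' else 0) =
            if r f < r f' then 1 else 0 := by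
        intro f f'
        rw [Finset.sum_eq_single f, Finset.sum_eq_single f']
        · simp
        · intro j _ hj
          simp [hj.symm]
        · simp
        · intro i _ hi
          simp [Pi.single_apply, hi.symm]
        · simp
      have h4 := h3 (o.faceOf h) (o.faceOf (o.next h))
      have h5 := h3 (o.faceOf (o.next h)) (o.faceOf h)
      simp only [σ]
      push_cast
      rw [← h4, ← h5, ← Finset.sum_sub_distrib]
      refine Finset.sum_congr rfl fun i _ => ?_
      rw [← Finset.sum_sub_distrib]
      refine Finset.sum_congr rfl fun j _ => ?_
      split_ifs <;> ring
    simp only [h2]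
    rw [Finset.sum_comm]
    refine Finset.sum_eq_zero fun i _ => ?_
    rw [Finset.sum_comm]
    refine Finset.sum_eq_zero fun j _ => ?_
    split_ifs
    · exact o.sum_mem_intersection_eq_zero hS _ _
    · simp
  have h2 : ∑ h with G.vertexOf h ∈ S, σ h = 0 := by exact_mod_cast h1
  have h3 : ∀ h, (σ h : ZMod 2) = 1 := by
    intro h
    have hne : r (o.faceOf (o.next h)) ≠ r (o.faceOf h) := fun h4 =>
      ho.faceOf_opp_ne hG h (by rw [← faceOf_next]; exact r.injective h4)
    rcases lt_or_gt_of_ne hne with h4 | h4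
    · simp [σ, h4, h4.not_gt]
    · simp [σ, h4, h4.not_gt]
  have h4 : ∑ h with G.vertexOf h ∈ S, (1 : ZMod 2) = 0 := by
    rw [← Finset.sum_congr rfl fun h _ => h3 h, ← Int.cast_sum, h2, Int.cast_zero]
  rw [Finset.sum_filter, o.sum_halfEdge] at h4
  simp only [vertexOf_next, vertexOf_halfAt] at h4
  have h5 : ∀ p : Prop, [Decidable p] → ((if p then (1 : ZMod 2) else 0) +
      ((if p then 1 else 0) + (if p then 1 else 0))) = if p then 1 else 0 := by
    intro p _
    split_ifs <;> decide
  simp only [h5] at h4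
  rw [← Finset.sum_filter] at h4
  simp only [Finset.filter_univ_mem, Finset.sum_const, nsmul_eq_mul, mul_one] at h4
  exact (ZMod.natCast_eq_zero_iff_even).1 h4

theorem coeff_facePolynomial_ne_zero {o : G.CyclicOrder} (ho : o.IsSpherical)
    (hG : G.TwoConnected) :
    o.facePolynomial.coeff (Fintype.card G.Vertex / 2 + 2) ≠ 0 := by
  classical
  rw [o.coeff_facePolynomial hG.1]
  have h1 : ∀ S : Finset G.Vertex, (if (o.flip S).IsSpherical then (-1 : ℂ) ^ S.card else 0) =
      ((if (o.flip S).IsSpherical then 1 else 0 : ℕ) : ℂ) := by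
    intro S
    split_ifs with hS
    · rw [(ho.even_card hG hS).neg_one_pow, Nat.cast_one]
    · simp
  simp only [h1]
  rw [← Nat.cast_sum, Nat.cast_ne_zero]
  refine (Finset.sum_pos' (fun _ _ => Nat.zero_le _) ⟨∅, Finset.mem_univ _, ?_⟩).ne'
  simp [ho]

end CyclicOrder

/-! ### Colorings of the edges and of the faces -/

/-- The four colors; the three nonzero ones are also used to color edges. -/
abbrev Color : Type := ZMod 2 × ZMod 2

namespace Color

/-- The sign of the cyclic order of the three nonzero colors, and zero on all other triples. -/
def sign (x y z : Color) : ℤ :=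
  if x ≠ 0 ∧ y ≠ 0 ∧ x ≠ y ∧ x + y = z then
    if (x, y) = ((1, 0), (0, 1)) ∨ (x, y) = ((0, 1), (1, 1)) ∨ (x, y) = ((1, 1), (1, 0)) then 1
    else -1
  else 0

theorem sign_rotate : ∀ x y z : Color, sign y z x = sign x y z := by decide

theorem sign_reverse : ∀ x y z : Color, sign x z y = -sign x y z := by decide

theorem sign_eq_or : ∀ x y z : Color, sign x y z ≠ 0 → sign x y z = 1 ∨ sign x y z = -1 := by
  decide

theorem add_eq_zero_of_sign_ne_zero : ∀ x y z : Color, sign x y z ≠ 0 → x + (y + z) = 0 := by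
  decide

theorem ne_zero_of_sign_ne_zero : ∀ x y z : Color, sign x y z ≠ 0 → x ≠ 0 := by decide

theorem sign_sub_ne_zero : ∀ x y z : Color, x ≠ y → y ≠ z → z ≠ x →
    sign (x - y) (y - z) (z - x) ≠ 0 := by decide

/-- Modulo four, the sign is the boundary of an antisymmetric function of pairs. -/
theorem sign_sub_eq : ∀ x y z : Color, x ≠ y → y ≠ z → z ≠ x →
    (sign (x - y) (y - z) (z - x) : ZMod 4) = -(sign x y (x + y) +
      (sign y z (y + z) + sign z x (z + x)) : ℤ) := by decide

theorem sign_add_swap : ∀ x y : Color, sign x y (x + y) + sign y x (y + x) = 0 := by decide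

end Color

namespace CyclicOrder

/-- A coloring of the edges by the three nonzero colors such that the three edges at every vertex
have different colors. -/
structure IsTait (o : G.CyclicOrder) (χ : G.HalfEdge → Color) : Prop where
  opp : ∀ h, χ (G.opp h) = χ h
  sign_ne_zero : ∀ h, Color.sign (χ h) (χ (o.next h)) (χ (o.next (o.next h))) ≠ 0

/-- Tait's construction: an edge receives the difference of the colors on its two sides. `hne` is
needed since a face may otherwise border itself, where the coloring imposes nothing. -/
theorem exists_isTait_of_colorable {o : G.CyclicOrder} (hc : o.mapGraph.Colorable 4)
    (hne : ∀ h, o.faceOf (G.opp h) ≠ o.faceOf h) : ∃ χ, o.IsTait χ := by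
  obtain ⟨κ⟩ := hc
  have e : Fin 4 ≃ Color := Fintype.equivOfCardEq (by decide)
  let n : G.HalfEdge → Color := fun h => e (κ (o.faceOf h))
  have h1 : ∀ h, n h ≠ n (o.next h) := by
    intro h h2
    rw [show n (o.next h) = n (G.opp h) by simp only [n, faceOf_next]] at h2
    exact κ.valid (v := o.faceOf h) (w := o.faceOf (G.opp h)) ⟨(hne h).symm, h, rfl, rfl⟩
      (e.injective h2)
  refine ⟨fun h => n h - n (o.next h), fun h => ?_, fun h => ?_⟩
  · simp only [n, faceOf_next, G.opp_opp]
    generalize e (κ (o.faceOf h)) = x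
    generalize e (κ (o.faceOf (G.opp h))) = y
    revert x y
    decide
  · rw [next_next_next]
    refine Color.sign_sub_ne_zero _ _ _ (h1 _) (h1 _) ?_
    simpa using h1 (o.next (o.next h))

/-- On the sphere, edge colorings come from face colorings. -/
theorem IsSpherical.exists_potential_of_isTait {o : G.CyclicOrder} (ho : o.IsSpherical)
    {χ : G.HalfEdge → Color} (hχ : o.IsTait χ) :
    ∃ g : o.Face → Color, ∀ h, χ h = g (o.faceOf h) - g (o.faceOf (G.opp h)) := by
  -- Three different nonzero colors add to zero, so both coordinates are flows over `ZMod 2`.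
  have h0 := fun h => Color.add_eq_zero_of_sign_ne_zero _ _ _ (hχ.sign_ne_zero h)
  have h1 : (fun h => (χ h).1) ∈ G.flows (ZMod 2) := o.mem_flows_iff.2
    ⟨fun h => by rw [hχ.opp, ZMod.neg_eq_self_mod_two], fun h => congrArg Prod.fst (h0 h)⟩
  have h2 : (fun h => (χ h).2) ∈ G.flows (ZMod 2) := o.mem_flows_iff.2
    ⟨fun h => by rw [hχ.opp, ZMod.neg_eq_self_mod_two], fun h => congrArg Prod.snd (h0 h)⟩
  obtain ⟨g₁, hg₁⟩ := ho.exists_potential h1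
  obtain ⟨g₂, hg₂⟩ := ho.exists_potential h2
  exact ⟨fun f => (g₁ f, g₂ f), fun h => Prod.ext (hg₁ h) (hg₂ h)⟩

theorem IsSpherical.colorable_of_isTait {o : G.CyclicOrder} (ho : o.IsSpherical)
    {χ : G.HalfEdge → Color} (hχ : o.IsTait χ) : o.mapGraph.Colorable 4 := by
  obtain ⟨g, hg⟩ := ho.exists_potential_of_isTait hχ
  have h1 : Fintype.card Color = 4 := by decide
  rw [← h1]
  refine (SimpleGraph.Coloring.mk g ?_).colorable
  rintro _ _ ⟨-, h, rfl, rfl⟩ h2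
  have h3 := hg h
  rw [h2, sub_self] at h3
  exact Color.ne_zero_of_sign_ne_zero _ _ _ (hχ.sign_ne_zero h) h3

/-- Modulo 4 the sum of the vertex signs is a sum over half-edges that cancels on every edge. With
`M` negative signs this says `4 ∣ v - 2M`, so `M` has the parity of `v/2`, whatever the coloring. -/
theorem IsSpherical.prod_sign_eq {o : G.CyclicOrder} (ho : o.IsSpherical)
    {χ : G.HalfEdge → Color} (hχ : o.IsTait χ) :
    ∏ v, Color.sign (χ (G.halfAt v)) (χ (o.next (G.halfAt v)))
      (χ (o.next (o.next (G.halfAt v)))) = (-1) ^ (Fintype.card G.Vertex / 2) := by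
  classical
  obtain ⟨g, hg⟩ := ho.exists_potential_of_isTait hχ
  let n : G.HalfEdge → Color := fun h => g (o.faceOf h)
  let ε : G.Vertex → ℤ := fun v => Color.sign (χ (G.halfAt v)) (χ (o.next (G.halfAt v)))
      (χ (o.next (o.next (G.halfAt v))))
  have hopp : ∀ h, n (G.opp h) = n (o.next h) := o.isPotential_comp_faceOf g
  have hn : ∀ h, χ h = n h - n (o.next h) := fun h => by rw [hg, ← hopp]
  have hne : ∀ h, n h ≠ n (o.next h) := fun h h1 => by
    have h2 := hn h
    rw [h1, sub_self] at h2
    exact Color.ne_zero_of_sign_ne_zero _ _ _ (hχ.sign_ne_zero h) h2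
  have h1 : ((∑ v, ε v : ℤ) : ZMod 4) = 0 := by
    let φ : G.HalfEdge → ℤ := fun h => Color.sign (n h) (n (o.next h)) (n h + n (o.next h))
    have h2 : ∀ v, (ε v : ZMod 4) = -(φ (G.halfAt v) + (φ (o.next (G.halfAt v)) +
        φ (o.next (o.next (G.halfAt v)))) : ℤ) := by
      intro v
      simp only [ε, φ, hn, next_next_next]
      refine Color.sign_sub_eq _ _ _ (hne _) (hne _) ?_
      simpa using hne (o.next (o.next (G.halfAt v)))
    have h3 : ∑ h, φ h = 0 := by
      rw [sum_halfEdge_eq_sum_edge]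
      refine Finset.sum_eq_zero fun e _ => ?_
      simp only [φ, ← hopp, G.opp_opp]
      exact Color.sign_add_swap _ _
    rw [Int.cast_sum, Finset.sum_congr rfl fun v _ => h2 v, Finset.sum_neg_distrib,
      ← Int.cast_sum, ← o.sum_halfEdge, h3]
    simp
  have h2 : ∀ s : Finset G.Vertex, ∃ M : ℕ, ∏ v ∈ s, ε v = (-1) ^ M ∧
      ∑ v ∈ s, ε v = s.card - 2 * M := by
    intro s
    induction s using Finset.induction_on with
    | empty => exact ⟨0, by simp⟩
    | insert v s hv ih =>
      obtain ⟨M, hM, hM'⟩ := ih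
      rcases Color.sign_eq_or _ _ _ (hχ.sign_ne_zero (G.halfAt v)) with h3 | h3
      · refine ⟨M, ?_, ?_⟩
        · rw [Finset.prod_insert hv, hM]; simp only [ε, h3, one_mul]
        · rw [Finset.sum_insert hv, hM', Finset.card_insert_of_notMem hv]
          simp only [ε, h3]; push_cast; ring
      · refine ⟨M + 1, ?_, ?_⟩
        · rw [Finset.prod_insert hv, hM]; simp only [ε, h3]; ring
        · rw [Finset.sum_insert hv, hM', Finset.card_insert_of_notMem hv]
          simp only [ε, h3]; push_cast; ring
  obtain ⟨M, hM, hM'⟩ := h2 Finset.univ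
  have h3 : (4 : ℤ) ∣ ∑ v, ε v := (ZMod.intCast_zmod_eq_zero_iff_dvd _ 4).1 h1
  rw [hM', Finset.card_univ] at h3
  have h5 := G.card_halfEdge_eq_three_mul
  have h6 := G.card_halfEdge_eq_two_mul
  change ∏ v, ε v = _
  rw [hM]
  exact neg_one_pow_congr (by rw [Nat.even_iff, Nat.even_iff]; omega)

end CyclicOrder

end TrivalentGraph

/-! ### Changing the tensor on the edges -/

universe u

/-- The two tensors are exchanged one slot at a time; `hΨ` says that a single slot cannot
distinguish them while the others are frozen. -/
theorem sum_fin_pi_prod_mul_eq {D R : Type*} {X Y : Type u} [CommRing R] [Fintype X]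
    [Fintype Y] [Nonempty D]
    (t : X → R) (b : X → D) (s : Y → R) (c : Y → D) (n : ℕ) (Ψ : (Fin n → D) → R)
    (hΨ : ∀ i r, ∑ x, t x * Ψ (Function.update r i (b x)) =
      ∑ y, s y * Ψ (Function.update r i (c y))) :
    ∑ r : Fin n → X, (∏ i, t (r i)) * Ψ (fun i => b (r i)) =
      ∑ r : Fin n → Y, (∏ i, s (r i)) * Ψ (fun i => c (r i)) := by
  induction n with
  | zero => simp; congr 1; exact Subsingleton.elim _ _
  | succ n ih =>
    have hcons : ∀ {Z : Type u} [Fintype Z] (w : Z → R) (d : Z → D),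
        ∑ r : Fin (n + 1) → Z, (∏ i, w (r i)) * Ψ (fun i => d (r i)) =
          ∑ z, w z * ∑ r : Fin n → Z, (∏ i, w (r i)) * Ψ (Fin.cons (d z) fun i => d (r i)) := by
      intro Z _ w d
      rw [← (Fin.consEquiv fun _ => Z).sum_comp, Fintype.sum_prod_type]
      refine Finset.sum_congr rfl fun z _ => ?_
      rw [Finset.mul_sum]
      refine Finset.sum_congr rfl fun r _ => ?_
      rw [Fin.prod_univ_succ, ← mul_assoc]
      congr 2
      ext i
      refine Fin.cases rfl (fun j => rfl) i
    rw [hcons, hcons]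
    have h1 : ∀ x, ∑ r : Fin n → X, (∏ i, t (r i)) * Ψ (Fin.cons (b x) fun i => b (r i)) =
        ∑ r : Fin n → Y, (∏ i, s (r i)) * Ψ (Fin.cons (b x) fun i => c (r i)) := fun x =>
      ih (fun q => Ψ (Fin.cons (b x) q)) fun i r => by
        simp only [Fin.cons_update]
        exact hΨ _ _
    simp only [h1, Finset.mul_sum]
    rw [Finset.sum_comm]
    conv_rhs => rw [Finset.sum_comm]
    refine Finset.sum_congr rfl fun r _ => ?_
    -- The arbitrary value is immaterial: slot 0 is overwritten.
    have h2 := hΨ 0 (Fin.cons (Classical.arbitrary D) fun i => c (r i))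
    simp only [Fin.update_cons_zero] at h2
    have h3 : ∀ {Z : Type u} [Fintype Z] (w : Z → R) (d : Z → D),
        ∑ z, w z * ((∏ i, s (r i)) * Ψ (Fin.cons (d z) fun i => c (r i))) =
          (∏ i, s (r i)) * ∑ z, w z * Ψ (Fin.cons (d z) fun i => c (r i)) := by
      intro Z _ w d
      rw [Finset.mul_sum]
      exact Finset.sum_congr rfl fun _ _ => by ring
    rw [h3, h3, h2]

theorem sum_pi_prod_mul_eq {D R E : Type*} {X Y : Type u} [CommRing R] [Fintype X]
    [Fintype Y] [Nonempty D]
    [Fintype E] [DecidableEq E] (t : X → R) (b : X → D) (s : Y → R) (c : Y → D) (Ψ : (E → D) → R)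
    (hΨ : ∀ e r, ∑ x, t x * Ψ (Function.update r e (b x)) =
      ∑ y, s y * Ψ (Function.update r e (c y))) :
    ∑ r : E → X, (∏ e, t (r e)) * Ψ (fun e => b (r e)) =
      ∑ r : E → Y, (∏ e, s (r e)) * Ψ (fun e => c (r e)) := by
  let ε := Fintype.equivFin E
  have hε : ∀ {Z : Type u} [Fintype Z] (w : Z → R) (d : Z → D),
      ∑ r : E → Z, (∏ e, w (r e)) * Ψ (fun e => d (r e)) =
        ∑ r : Fin _ → Z, (∏ i, w (r i)) * Ψ (fun e => d (r (ε e))) := by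
    intro Z _ w d
    rw [← (Equiv.arrowCongr ε.symm (Equiv.refl Z)).sum_comp]
    refine Finset.sum_congr rfl fun r _ => ?_
    rw [← ε.prod_comp]
    rfl
  rw [hε, hε]
  refine sum_fin_pi_prod_mul_eq t b s c _ (fun q => Ψ fun e => q (ε e)) fun i r => ?_
  have h1 : ∀ d : D, (fun e => Function.update r i d (ε e)) =
      Function.update (fun e => r (ε e)) (ε.symm i) d := by
    intro d
    ext e
    simp only [Function.update_apply, Equiv.eq_symm_apply]
  simp only [h1]
  exact hΨ _ _

namespace TrivalentGraph

variable {G : TrivalentGraph}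

/-- Labellings of the half-edges are the same as labellings of the edges by pairs. -/
noncomputable def pairEquiv (G : TrivalentGraph) (X : Type*) :
    (G.Edge → X × X) ≃ (G.HalfEdge → X) where
  toFun r h := if (G.edgeBoolEquiv.symm h).2 then (r (G.edgeBoolEquiv.symm h).1).2
    else (r (G.edgeBoolEquiv.symm h).1).1
  invFun ℓ e := (ℓ (G.halfOf e), ℓ (G.opp (G.halfOf e)))
  left_inv r := by
    ext e
    · simp [← edgeBoolEquiv_false]
    · simp [← edgeBoolEquiv_true]
  right_inv ℓ := by
    ext h
    obtain ⟨⟨e, b⟩, rfl⟩ := G.edgeBoolEquiv.surjective h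
    cases b <;> dsimp only <;> rw [Equiv.symm_apply_apply] <;> rfl

@[simp]
theorem pairEquiv_halfOf {X : Type*} (r : G.Edge → X × X) (e : G.Edge) :
    G.pairEquiv X r (G.halfOf e) = (r e).1 :=
  congrArg Prod.fst (congrFun ((G.pairEquiv X).symm_apply_apply r) e)

@[simp]
theorem pairEquiv_opp_halfOf {X : Type*} (r : G.Edge → X × X) (e : G.Edge) :
    G.pairEquiv X r (G.opp (G.halfOf e)) = (r e).2 :=
  congrArg Prod.snd (congrFun ((G.pairEquiv X).symm_apply_apply r) e)

theorem pairEquiv_map {X Y : Type*} (f : X → Y) (r : G.Edge → X × X) :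
    G.pairEquiv Y (fun e => Prod.map f f (r e)) = fun h => f (G.pairEquiv X r h) := by
  ext h
  obtain ⟨e, rfl | rfl⟩ := exists_edge_of_halfEdge h <;> simp

theorem halfOf_injective : Function.Injective G.halfOf := fun e e' h => by
  have h1 := G.edgeBoolEquiv.injective (a₁ := (e, false)) (a₂ := (e', false)) h
  exact congrArg Prod.fst h1

theorem halfOf_ne_opp_halfOf (e e' : G.Edge) : G.halfOf e ≠ G.opp (G.halfOf e') := fun h => by
  have h1 := G.edgeBoolEquiv.injective (a₁ := (e, false)) (a₂ := (e', true)) h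
  exact absurd (congrArg Prod.snd h1) (by simp)

theorem pairEquiv_update {X : Type*} [DecidableEq G.Edge] [DecidableEq G.HalfEdge]
    (r : G.Edge → X × X) (e : G.Edge) (p : X × X) :
    G.pairEquiv X (Function.update r e p) =
      Function.update (Function.update (G.pairEquiv X r) (G.halfOf e) p.1)
        (G.opp (G.halfOf e)) p.2 := by
  ext h
  obtain ⟨e', rfl | rfl⟩ := exists_edge_of_halfEdge h
  · by_cases h1 : e' = e
    · subst h1
      simp [halfOf_ne_opp_halfOf]
    · simp [halfOf_ne_opp_halfOf, h1, halfOf_injective.eq_iff]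
  · by_cases h1 : e' = e
    · subst h1
      simp
    · simp [(halfOf_ne_opp_halfOf _ _).symm, h1, halfOf_injective.eq_iff]

end TrivalentGraph

/-! ### Computing weights from any representation of the Casimir tensor. -/

namespace LieMetric

open TrivalentGraph

variable {K L ι κ : Type*} [Field K] [LieRing L] [LieAlgebra K L]

theorem form_lie_cyclic (M : LieMetric K L) (x y z : L) : M.form x ⁅y, z⁆ = M.form y ⁅z, x⁆ := by
  rw [M.symm, M.invariant]

/-- The product over the vertices of `⟨x, [y, z]⟩`, where `x, y, z` are the labels around it. -/
noncomputable def vertexProduct (M : LieMetric K L) {G : TrivalentGraph} (o : G.CyclicOrder)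
    (x : G.HalfEdge → L) : K :=
  ∏ v, M.form (x (G.halfAt v)) ⁅x (o.next (G.halfAt v)), x (o.next (o.next (G.halfAt v)))⁆

/-- Only the factor at the vertex of `h` sees the label of `h`, and by cyclic symmetry its reading
may start at `h`. This makes the product linear in each label. -/
theorem exists_vertexProduct_update (M : LieMetric K L) {G : TrivalentGraph}
    [DecidableEq G.HalfEdge] (o : G.CyclicOrder) (x : G.HalfEdge → L) (h : G.HalfEdge) :
    ∃ r : K, ∀ y, M.vertexProduct o (Function.update x h y) =
      M.form y ⁅x (o.next h), x (o.next (o.next h))⁆ * r := by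
  classical
  refine ⟨∏ v ∈ Finset.univ.erase (G.vertexOf h),
    M.form (x (G.halfAt v)) ⁅x (o.next (G.halfAt v)), x (o.next (o.next (G.halfAt v)))⁆,
    fun y => ?_⟩
  rw [vertexProduct, ← Finset.mul_prod_erase _ _ (Finset.mem_univ (G.vertexOf h))]
  congr 1
  · have h1 : ∀ k, G.vertexOf k = G.vertexOf h → ∀ z : G.HalfEdge → L,
        M.form (z k) ⁅z (o.next k), z (o.next (o.next k))⁆ =
          M.form (z h) ⁅z (o.next h), z (o.next (o.next h))⁆ := by
      intro k hk z
      rcases (o.vertexOf_eq_iff h k).1 hk with rfl | rfl | rfl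
      · rfl
      · rw [o.next_next_next, M.form_lie_cyclic (z h)]
      · rw [o.next_next_next, M.form_lie_cyclic (z (o.next (o.next h)))]
    rw [h1 _ (vertexOf_halfAt _), Function.update_self, Function.update_of_ne (o.next_ne h),
      Function.update_of_ne (o.next_next_ne h)]
  · refine Finset.prod_congr rfl fun v hv => ?_
    have h1 : ∀ k, G.vertexOf k = v → Function.update x h y k = x k := by
      rintro k rfl
      exact Function.update_of_ne (fun h2 => Finset.ne_of_mem_erase hv (congrArg _ h2)) _ _
    rw [h1, h1, h1] <;> simp [CyclicOrder.vertexOf_next, vertexOf_halfAt]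

/-- The vertex product as a bilinear function of two of the labels. -/
theorem exists_bilinear_vertexProduct (M : LieMetric K L) {G : TrivalentGraph}
    [DecidableEq G.HalfEdge] (o : G.CyclicOrder) (x : G.HalfEdge → L) {h k : G.HalfEdge}
    (hk : h ≠ k) : ∃ g : L →ₗ[K] L →ₗ[K] K, ∀ y z,
      M.vertexProduct o (Function.update (Function.update x h y) k z) = g y z := by
  refine ⟨LinearMap.mk₂ K
    (fun y z => M.vertexProduct o (Function.update (Function.update x h y) k z)) ?_ ?_ ?_ ?_,
    fun _ _ => rfl⟩
  · intro y y' z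
    obtain ⟨r, hr⟩ := M.exists_vertexProduct_update o (Function.update x k z) h
    simp only [Function.update_comm hk, hr, map_add, LinearMap.add_apply, add_mul]
  · intro a y z
    obtain ⟨r, hr⟩ := M.exists_vertexProduct_update o (Function.update x k z) h
    simp only [Function.update_comm hk, hr, map_smul, LinearMap.smul_apply, smul_eq_mul, mul_assoc]
  · intro y z z'
    obtain ⟨r, hr⟩ := M.exists_vertexProduct_update o (Function.update x h y) k
    simp only [hr, map_add, LinearMap.add_apply, add_mul]
  · intro a y z
    obtain ⟨r, hr⟩ := M.exists_vertexProduct_update o (Function.update x h y) k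
    simp only [hr, map_smul, LinearMap.smul_apply, smul_eq_mul, mul_assoc]

theorem sum_inverseMetric_smul [Fintype ι] (M : LieMetric K L) (B : Module.Basis ι K L) (y : L) :
    ∑ a, (∑ b, M.inverseMetric B a b * M.form (B b) y) • B a = y := by
  classical
  have hfin : FiniteDimensional K L := Module.Finite.of_basis B
  have h1 : M.inverseMetric B * LinearMap.BilinForm.toMatrix B M.form = 1 := by
    have h2 : IsUnit (LinearMap.BilinForm.toMatrix B M.form).det :=
      isUnit_iff_ne_zero.2 ((LinearMap.BilinForm.nondegenerate_iff_det_ne_zero B).1 M.nondegenerate)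
    have h3 := Matrix.nonsing_inv_mul _ h2
    unfold inverseMetric
    convert h3
  conv_rhs => rw [← B.sum_repr y]
  refine Finset.sum_congr rfl fun a _ => ?_
  congr 1
  calc ∑ b, M.inverseMetric B a b * M.form (B b) y
      = ∑ c, (M.inverseMetric B * LinearMap.BilinForm.toMatrix B M.form) a c * B.repr y c := by
        conv_lhs => rw [← B.sum_repr y]
        simp only [map_sum, map_smul, smul_eq_mul, Matrix.mul_apply, Finset.mul_sum,
          Finset.sum_mul, LinearMap.BilinForm.toMatrix_apply]
        rw [Finset.sum_comm]
        refine Finset.sum_congr rfl fun c _ => Finset.sum_congr rfl fun b _ => by ring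
    _ = B.repr y a := by simp [h1, Matrix.one_apply]

/-- The inverse metric is determined by the reproducing property of the Casimir tensor. -/
theorem sum_inverseMetric_mul [Fintype ι] [Fintype κ] (M : LieMetric K L) (B : Module.Basis ι K L)
    (s : κ → κ → K) (C : κ → L) (hC : ∀ x, ∑ i, ∑ j, (s i j * M.form (C i) x) • C j = x)
    (g : L →ₗ[K] L →ₗ[K] K) :
    ∑ p : ι × ι, M.inverseMetric B p.1 p.2 * g (B p.1) (B p.2) =
      ∑ p : κ × κ, s p.1 p.2 * g (C p.1) (C p.2) := by
  have h1 : ∀ b, ∀ y, g y (B b) =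
      ∑ q : κ × κ, s q.1 q.2 * M.form (C q.1) (B b) * g y (C q.2) := by
    intro b y
    conv_lhs => rw [← hC (B b)]
    simp only [map_sum, map_smul, smul_eq_mul, Fintype.sum_prod_type]
  have h2 : ∀ i, ∀ z, g (C i) z =
      ∑ p : ι × ι, M.inverseMetric B p.1 p.2 * M.form (B p.2) (C i) * g (B p.1) z := by
    intro i z
    conv_lhs => rw [← M.sum_inverseMetric_smul B (C i)]
    simp only [map_sum, map_smul, smul_eq_mul, LinearMap.sum_apply, LinearMap.smul_apply,
      Finset.sum_mul, Fintype.sum_prod_type]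
  -- Expanding the second argument on the left in `C` and the first argument on the right in `B`
  -- gives the same fourfold sum.
  simp only [h1 _ (B _), h2, Finset.mul_sum]
  rw [Finset.sum_comm]
  refine Finset.sum_congr rfl fun p _ => Finset.sum_congr rfl fun q _ => ?_
  rw [M.symm (C p.1)]
  ring

open Classical in
theorem weightInBasis_eq_sum [Fintype ι] (M : LieMetric K L) (B : Module.Basis ι K L)
    (G : TrivalentGraph) (o : G.CyclicOrder) :
    M.weightInBasis B G o = ∑ m : G.HalfEdge → ι, M.vertexProduct o (fun h => B (m h)) *
      ∏ e, M.inverseMetric B (m (G.halfOf e)) (m (G.opp (G.halfOf e))) := by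
  simp only [weightInBasis, vertexProduct, structureConstant]

open Classical in
theorem sum_vertexProduct_mul_eq [Fintype κ] (M : LieMetric K L) (G : TrivalentGraph)
    (o : G.CyclicOrder) (s : κ → κ → K) (C : κ → L) :
    (∑ m : G.HalfEdge → κ, M.vertexProduct o (fun h => C (m h)) *
        ∏ e, s (m (G.halfOf e)) (m (G.opp (G.halfOf e)))) =
      ∑ r : G.Edge → κ × κ, (∏ e, s (r e).1 (r e).2) *
        M.vertexProduct o (G.pairEquiv L fun e => Prod.map C C (r e)) := by
  rw [← (G.pairEquiv κ).sum_comp]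
  refine Finset.sum_congr rfl fun r _ => ?_
  rw [mul_comm, pairEquiv_map]
  simp

open Classical in
/-- The weight can be computed with any family that represents the Casimir tensor. -/
theorem weight_eq_sum {κ : Type} [FiniteDimensional K L] [Fintype κ] (M : LieMetric K L)
    (G : TrivalentGraph) (o : G.CyclicOrder) (s : κ → κ → K) (C : κ → L)
    (hC : ∀ x, ∑ i, ∑ j, (s i j * M.form (C i) x) • C j = x) :
    M.weight G o = ∑ m : G.HalfEdge → κ, M.vertexProduct o (fun h => C (m h)) *
      ∏ e, s (m (G.halfOf e)) (m (G.opp (G.halfOf e))) := by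
  rw [weight, weightInBasis_eq_sum]
  generalize Module.finBasis K L = B
  have h1 := M.sum_vertexProduct_mul_eq G o (fun a b => M.inverseMetric B a b) B
  have h2 := M.sum_vertexProduct_mul_eq G o s C
  rw [h2]
  refine Eq.trans h1 ?_
  refine sum_pi_prod_mul_eq (fun p : _ × _ => M.inverseMetric B p.1 p.2) (Prod.map B B)
    (fun p : _ × _ => s p.1 p.2) (Prod.map C C)
    (fun q => M.vertexProduct o (G.pairEquiv L q)) fun e r => ?_
  obtain ⟨g, hg⟩ := M.exists_bilinear_vertexProduct o (G.pairEquiv L r)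
    (G.opp_ne (G.halfOf e)).symm
  simp only [pairEquiv_update, hg]
  exact M.sum_inverseMetric_mul B s C hC g

end LieMetric

open TrivalentGraph

/-! ### Evaluation in `sl(N)` -/

theorem slMetric_form_lie (N : ℕ) (x y z : SlLie N) :
    (slMetric N).form x ⁅y, z⁆ = Matrix.trace (x.val * (y.val * z.val - z.val * y.val)) := rfl

theorem trace_eq_zero_of_slLie {N : ℕ} (x : SlLie N) : Matrix.trace x.val = 0 := by
  have h := x.2
  simpa [LieAlgebra.SpecialLinear.sl] using h

/-- The traceless part of a matrix. -/
noncomputable def slProj (N : ℕ) (A : Matrix (Fin N) (Fin N) ℂ) : SlLie N :=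
  ⟨A - (Matrix.trace A / N) • 1, by
    suffices Matrix.trace (A - (Matrix.trace A / N) • (1 : Matrix (Fin N) (Fin N) ℂ)) = 0 by
      simpa [LieAlgebra.SpecialLinear.sl] using this
    rcases Nat.eq_zero_or_pos N with rfl | hN
    · simp [Matrix.trace]
    · have : (N : ℂ) ≠ 0 := by exact_mod_cast hN.ne'
      simp [this]⟩

theorem val_slProj (N : ℕ) (A : Matrix (Fin N) (Fin N) ℂ) :
    (slProj N A).val = A - (Matrix.trace A / N) • 1 := rfl

/-- Scalar parts drop out of the commutator, and the remaining one multiplies the trace of a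
commutator. -/
theorem slMetric_form_lie_slProj (N : ℕ) (A B C : Matrix (Fin N) (Fin N) ℂ) :
    (slMetric N).form (slProj N A) ⁅slProj N B, slProj N C⁆ =
      Matrix.trace (A * B * C) - Matrix.trace (A * C * B) := by
  have h1 : ∀ b c : ℂ, (B - b • 1) * (C - c • 1) - (C - c • 1) * (B - b • 1) = B * C - C * B := by
    intro b c
    simp only [sub_mul, mul_sub, smul_mul_assoc, mul_smul_comm, one_mul, mul_one]
    module
  rw [slMetric_form_lie, val_slProj, val_slProj, val_slProj, h1, sub_mul, Matrix.trace_sub,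
    smul_mul_assoc, one_mul, Matrix.trace_smul, Matrix.trace_sub, Matrix.trace_mul_comm C B,
    sub_self, smul_zero, sub_zero, mul_sub, Matrix.trace_sub, mul_assoc, mul_assoc]

/-- Pairing with the projection of `E_ij` reads off the entry `x_ji`. The `N²` projections are
linearly dependent for `N ≥ 1`, hence a criterion for arbitrary families instead of bases. -/
theorem sum_slProj_single (N : ℕ) (x : SlLie N) :
    ∑ i : Fin N × Fin N, ∑ j : Fin N × Fin N, ((if j = i.swap then 1 else 0) *
      (slMetric N).form (slProj N (Matrix.single i.1 i.2 1)) x) •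
        slProj N (Matrix.single j.1 j.2 1) = x := by
  have h1 : ∀ i : Fin N × Fin N, (slMetric N).form (slProj N (Matrix.single i.1 i.2 1)) x =
      x.val i.2 i.1 := by
    intro i
    have h0 : ∀ y, (slMetric N).form y x = Matrix.trace (y.val * x.val) := fun _ => rfl
    rw [h0, val_slProj, sub_mul, Matrix.trace_sub, smul_mul_assoc, one_mul, Matrix.trace_smul,
      trace_eq_zero_of_slLie, smul_zero, sub_zero, Matrix.trace_single_mul]
    simp
  have h2 : ∀ i : Fin N × Fin N, ∑ j : Fin N × Fin N, ((if j = i.swap then 1 else 0) *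
      (slMetric N).form (slProj N (Matrix.single i.1 i.2 1)) x) •
        slProj N (Matrix.single j.1 j.2 1) =
      x.val i.2 i.1 • slProj N (Matrix.single i.2 i.1 1) := by
    intro i
    rw [Finset.sum_eq_single i.swap]
    · simp [h1]
    · intro j _ hj
      simp [hj]
    · simp
  simp only [h2]
  apply Subtype.ext
  have h3 : ∑ i : Fin N × Fin N, x.val i.2 i.1 • Matrix.single i.2 i.1 (1 : ℂ) = x.val := by
    rw [Fintype.sum_prod_type, Finset.sum_comm]
    conv_rhs => rw [Matrix.matrix_eq_sum_single x.val]
    simp [Matrix.smul_single]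
  have h4 : ((∑ i : Fin N × Fin N, x.val i.2 i.1 • slProj N (Matrix.single i.2 i.1 1) :
      SlLie N)).val = ∑ i : Fin N × Fin N, x.val i.2 i.1 •
        (slProj N (Matrix.single i.2 i.1 1)).val := by
    rw [AddSubmonoidClass.coe_finsetSum]
    rfl
  have h5 : ∑ i : Fin N × Fin N, x.val i.2 i.1 *
      Matrix.trace (Matrix.single i.2 i.1 (1 : ℂ)) = 0 := by
    rw [← trace_eq_zero_of_slLie x]
    conv_rhs => rw [← h3]
    rw [Matrix.trace_sum]
    simp only [Matrix.trace_smul, smul_eq_mul]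
  rw [h4]
  simp only [val_slProj, smul_sub, Finset.sum_sub_distrib, h3, smul_smul, ← Finset.sum_smul,
    ← mul_div_assoc, ← Finset.sum_div, h5]
  simp

theorem trace_single_mul_single_mul_single {N : ℕ} (a b c d e f : Fin N) :
    Matrix.trace (Matrix.single a b (1 : ℂ) * Matrix.single c d 1 * Matrix.single e f 1) =
      if b = c ∧ d = e ∧ f = a then 1 else 0 := by
  by_cases h1 : b = c
  · subst h1
    rw [Matrix.single_mul_single_same]
    by_cases h2 : d = e
    · subst h2
      rw [Matrix.single_mul_single_same]
      by_cases h3 : f = a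
      · subst h3; simp
      · simp [h3, Matrix.trace_single_eq_of_ne, Ne.symm h3]
    · rw [Matrix.single_mul_single_of_ne _ _ _ _ h2]; simp [h2]
  · rw [Matrix.single_mul_single_of_ne _ _ _ _ h1]; simp [h1]

namespace TrivalentGraph

variable {G : TrivalentGraph}

namespace CyclicOrder

theorem isPotential_iff (o : G.CyclicOrder) {X : Type*} (n : G.HalfEdge → X) :
    o.IsPotential n ↔ ∀ v, n (G.opp (G.halfAt v)) = n (o.next (G.halfAt v)) ∧
      n (G.opp (o.next (G.halfAt v))) = n (o.next (o.next (G.halfAt v))) ∧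
      n (G.opp (o.next (o.next (G.halfAt v)))) = n (G.halfAt v) := by
  constructor
  · intro h v
    exact ⟨h _, h _, by rw [h, o.next_next_next]⟩
  · intro h k
    obtain ⟨h1, h2, h3⟩ := h (G.vertexOf k)
    rcases (o.vertexOf_eq_iff _ k).1 (vertexOf_halfAt (G.vertexOf k)).symm with h4 | h4 | h4 <;>
      rw [h4]
    · exact h1
    · exact h2
    · rw [o.next_next_next]; exact h3

open Classical in
theorem flip_isPotential_iff (o : G.CyclicOrder) (S : Finset G.Vertex) {X : Type*}
    (n : G.HalfEdge → X) :
    (o.flip S).IsPotential n ↔ ∀ v, if v ∈ S then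
      (n (G.opp (G.halfAt v)) = n (o.next (o.next (G.halfAt v))) ∧
      n (G.opp (o.next (o.next (G.halfAt v)))) = n (o.next (G.halfAt v)) ∧
      n (G.opp (o.next (G.halfAt v))) = n (G.halfAt v)) else
      (n (G.opp (G.halfAt v)) = n (o.next (G.halfAt v)) ∧
      n (G.opp (o.next (G.halfAt v))) = n (o.next (o.next (G.halfAt v))) ∧
      n (G.opp (o.next (o.next (G.halfAt v)))) = n (G.halfAt v)) := by
  rw [isPotential_iff]
  refine forall_congr' fun v => ?_
  have hv := vertexOf_halfAt v
  split_ifs with h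
  · rw [flip_next_of_mem _ (by rwa [hv]), flip_next_of_mem _ (by simpa [vertexOf_next, hv])]
    simp
  · rw [flip_next_of_notMem _ (by rwa [hv]), flip_next_of_notMem _ (by simpa [vertexOf_next, hv])]

-- Choosing `-tr(ACB)` at the vertices of `S` and `tr(ABC)` elsewhere gives the sign, and the index
-- equations in the chosen traces say that `i` is constant along the faces of `o.flip S`.
open Classical in
theorem vertexProduct_single (o : G.CyclicOrder) (N : ℕ) (i : G.HalfEdge → Fin N) :
    (slMetric N).vertexProduct o
      (fun h => slProj N (Matrix.single (i h) (i (G.opp h)) 1)) =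
      ∑ S : Finset G.Vertex, (-1) ^ S.card * if (o.flip S).IsPotential i then 1 else 0 := by
  simp only [LieMetric.vertexProduct, slMetric_form_lie_slProj, trace_single_mul_single_mul_single]
  simp only [sub_eq_neg_add]
  rw [Finset.prod_add, Finset.powerset_univ]
  refine Finset.sum_congr rfl fun S _ => ?_
  rw [Finset.prod_neg, mul_assoc]
  congr 1
  have h1 : Finset.univ \ S = Finset.univ.filter fun v => v ∉ S := by ext; simp
  have h2 : S = Finset.univ.filter fun v => v ∈ S := by ext; simp
  rw [h1]
  conv_lhs => enter [1, 1]; rw [h2]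
  rw [← Finset.prod_ite]
  have h3 : ∀ (v) (a b : Prop) [Decidable a] [Decidable b],
      (if v ∈ S then (if a then (1 : ℂ) else 0) else if b then 1 else 0) =
      if (if v ∈ S then a else b) then 1 else 0 := by
    intro v a b _ _
    by_cases h : v ∈ S <;> simp [h]
  simp only [h3, Finset.prod_ite_zero, Finset.prod_const_one]
  refine if_congr ?_ rfl rfl
  rw [flip_isPotential_iff]
  simp

/-- `W_{sl(N)}(G)` is computed by the signed count of the faces of all cyclic orders. -/
theorem eval_facePolynomial (o : G.CyclicOrder) (N : ℕ) :
    o.facePolynomial.eval (N : ℂ) = o.slWeight N := by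
  classical
  rw [slWeight, LieMetric.weight_eq_sum (slMetric N) G o
    (fun i j : Fin N × Fin N => if j = i.swap then 1 else 0)
    (fun i : Fin N × Fin N => slProj N (Matrix.single i.1 i.2 1)) (sum_slProj_single N)]
  have h1 : ∑ i : G.HalfEdge → Fin N, (slMetric N).vertexProduct o
      (fun h => slProj N (Matrix.single (i h) (i (G.opp h)) 1)) =
      ∑ m : G.HalfEdge → Fin N × Fin N, (slMetric N).vertexProduct o
        (fun h => slProj N (Matrix.single (m h).1 (m h).2 1)) *
        ∏ e, if m (G.opp (G.halfOf e)) = (m (G.halfOf e)).swap then 1 else 0 := by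
    -- The edge factors force `m (opp h)` to be the swap of `m h`, so only labellings of this form
    -- contribute.
    refine Fintype.sum_of_injective (fun i h => (i h, i (G.opp h))) ?_ _ _ ?_ ?_
    · intro i i' h
      ext h'
      have h2 := congrFun h h'
      exact congrArg _ (Prod.ext_iff.1 h2).1
    · intro m hm
      rw [Finset.prod_ite_zero, if_neg, mul_zero]
      intro h
      refine hm ⟨fun h => (m h).1, funext fun k => ?_⟩
      obtain ⟨e, rfl | rfl⟩ := exists_edge_of_halfEdge k
      · simp only [h e (Finset.mem_univ _)]
        rfl
      · simp only [G.opp_opp, h e (Finset.mem_univ _)]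
        rfl
    · intro i
      simp [G.opp_opp]
  rw [← h1]
  simp only [vertexProduct_single]
  rw [Finset.sum_comm, facePolynomial, Polynomial.eval_finsetSum]
  refine Finset.sum_congr rfl fun S _ => ?_
  rw [← Finset.mul_sum]
  have h2 := (o.flip S).card_potential (Fin N)
  rw [Nat.card_eq_fintype_card, Fintype.card_subtype, Fintype.card_fin] at h2
  have h3 : (∑ i : G.HalfEdge → Fin N, if (o.flip S).IsPotential i then (1 : ℂ) else 0) =
      (N : ℂ) ^ Fintype.card (o.flip S).Face := by
    rw [Finset.sum_boole, h2, Nat.cast_pow]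
  rw [h3]
  simp

theorem slTop_eq (o : G.CyclicOrder) :
    o.slTop = o.facePolynomial.coeff (Fintype.card G.Vertex / 2 + 2) := by
  have h : ∃ P, o.IsSlPolynomial P := ⟨o.facePolynomial, fun N _ => o.eval_facePolynomial N⟩
  rw [slTop, dif_pos h]
  congr 1
  refine Polynomial.eq_of_infinite_eval_eq _ _ ?_
  -- The shift by one is due to `IsSlPolynomial` speaking only of `N ≥ 1`.
  refine Set.Infinite.mono (s := Set.range fun N : ℕ => ((N + 1 : ℕ) : ℂ)) ?_
    (Set.infinite_range_of_injective fun a b hab => by simpa using hab)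
  rintro _ ⟨N, rfl⟩
  change Polynomial.eval _ _ = Polynomial.eval _ _
  rw [h.choose_spec _ (by omega), o.eval_facePolynomial]

end CyclicOrder

end TrivalentGraph

/-! ### Evaluation in `sl(2)` -/

/-- The three nonzero colors as the Pauli matrices. -/
noncomputable def pauli (x : Color) : Matrix (Fin 2) (Fin 2) ℂ :=
  !![((if x = (1, 1) then 1 else 0 : ℤ) : ℂ),
      ((if x = (1, 0) then 1 else 0 : ℤ) : ℂ) - Complex.I * ((if x = (0, 1) then 1 else 0 : ℤ) : ℂ);
    ((if x = (1, 0) then 1 else 0 : ℤ) : ℂ) + Complex.I * ((if x = (0, 1) then 1 else 0 : ℤ) : ℂ),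
      -((if x = (1, 1) then 1 else 0 : ℤ) : ℂ)]

theorem trace_pauli (x : Color) : Matrix.trace (pauli x) = 0 := by
  simp [pauli, Matrix.trace_fin_two]

/-- The color 0 yields the zero vector, so labellings by all four colors may be used. -/
noncomputable def slPauli (x : Color) : SlLie 2 :=
  ⟨pauli x, by simpa [LieAlgebra.SpecialLinear.sl] using trace_pauli x⟩

/-- The sign is the determinant of the indicator coordinates (`h1`), and the trace is `4i` times
that determinant. -/
theorem slMetric_form_lie_slPauli (x y z : Color) :
    (slMetric 2).form (slPauli x) ⁅slPauli y, slPauli z⁆ = 4 * Complex.I * Color.sign x y z := by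
  have h1 : ∀ x y z : Color, Color.sign x y z =
      (if x = (1, 0) then 1 else 0 : ℤ) * ((if y = (0, 1) then 1 else 0 : ℤ) *
          (if z = (1, 1) then 1 else 0 : ℤ) - (if y = (1, 1) then 1 else 0 : ℤ) *
          (if z = (0, 1) then 1 else 0 : ℤ))
      + (if x = (0, 1) then 1 else 0 : ℤ) * ((if y = (1, 1) then 1 else 0 : ℤ) *
          (if z = (1, 0) then 1 else 0 : ℤ) - (if y = (1, 0) then 1 else 0 : ℤ) *
          (if z = (1, 1) then 1 else 0 : ℤ))
      + (if x = (1, 1) then 1 else 0 : ℤ) * ((if y = (1, 0) then 1 else 0 : ℤ) *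
          (if z = (0, 1) then 1 else 0 : ℤ) - (if y = (0, 1) then 1 else 0 : ℤ) *
          (if z = (1, 0) then 1 else 0 : ℤ)) := by decide
  rw [slMetric_form_lie, h1]
  change Matrix.trace (pauli x * (pauli y * pauli z - pauli z * pauli y)) = _
  rw [pauli, pauli, pauli, Matrix.trace_fin_two]
  simp only [Int.cast_add, Int.cast_mul, Int.cast_sub]
  generalize ((if x = (1, 0) then 1 else 0 : ℤ) : ℂ) = x1
  generalize ((if x = (0, 1) then 1 else 0 : ℤ) : ℂ) = x2
  generalize ((if x = (1, 1) then 1 else 0 : ℤ) : ℂ) = x3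
  generalize ((if y = (1, 0) then 1 else 0 : ℤ) : ℂ) = y1
  generalize ((if y = (0, 1) then 1 else 0 : ℤ) : ℂ) = y2
  generalize ((if y = (1, 1) then 1 else 0 : ℤ) : ℂ) = y3
  generalize ((if z = (1, 0) then 1 else 0 : ℤ) : ℂ) = z1
  generalize ((if z = (0, 1) then 1 else 0 : ℤ) : ℂ) = z2
  generalize ((if z = (1, 1) then 1 else 0 : ℤ) : ℂ) = z3
  simp [Matrix.mul_apply, Fin.sum_univ_two]
  ring

/-- The factor `1/2` compensates `tr(σ_a σ_b) = 2δ_ab`. -/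
theorem sum_slPauli (X : SlLie 2) :
    ∑ x, ∑ y, ((if x = y then 1 / 2 else 0) * (slMetric 2).form (slPauli x) X) • slPauli y = X := by
  have h1 : ∀ x, ∑ y, ((if x = y then 1 / 2 else 0) * (slMetric 2).form (slPauli x) X) • slPauli y =
      (1 / 2 * (slMetric 2).form (slPauli x) X) • slPauli x := by
    intro x
    rw [Finset.sum_eq_single x]
    · simp
    · intro y _ hy
      simp [hy.symm]
    · simp
  have h2 : ∀ x, (slMetric 2).form (slPauli x) X = Matrix.trace (pauli x * X.val) := fun x => rfl
  have h3 : X.val 1 1 = -X.val 0 0 := by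
    have := trace_eq_zero_of_slLie X
    rw [Matrix.trace_fin_two] at this
    linear_combination this
  simp only [h1]
  simp only [h2]
  apply Subtype.ext
  have h4 : ((∑ x, (1 / 2 * Matrix.trace (pauli x * X.val)) • slPauli x : SlLie 2)).val =
      ∑ x, (1 / 2 * Matrix.trace (pauli x * X.val)) • pauli x := by
    rw [AddSubmonoidClass.coe_finsetSum]
    rfl
  have h5 : ∀ F : ZMod 2 → Matrix (Fin 2) (Fin 2) ℂ, ∑ a, F a = F 0 + F 1 := Fin.sum_univ_two
  rw [h4, Fintype.sum_prod_type]
  simp only [h5, Matrix.trace_fin_two]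
  ext i j
  fin_cases i <;> fin_cases j <;>
    simp [pauli, Matrix.mul_apply, Fin.sum_univ_two, h3] <;>
    first
    | ring1
    | linear_combination (X.val 1 0 - X.val 0 1) / 2 * Complex.I_sq
    | linear_combination (X.val 0 1 - X.val 1 0) / 2 * Complex.I_sq

/-! ### The weight of `sl(2)` as a signed count of Tait colorings. -/

namespace TrivalentGraph

variable {G : TrivalentGraph}

namespace CyclicOrder

open Classical in
/-- The signed number of edge colorings with three colors. -/
noncomputable def taitSum (o : G.CyclicOrder) : ℤ :=
  ∑ χ : G.HalfEdge → Color, if ∀ h, χ (G.opp h) = χ h then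
    ∏ v, Color.sign (χ (G.halfAt v)) (χ (o.next (G.halfAt v)))
      (χ (o.next (o.next (G.halfAt v)))) else 0

theorem slWeight_two (o : G.CyclicOrder) :
    o.slWeight 2 = (4 * Complex.I) ^ Fintype.card G.Vertex * (1 / 2) ^ Fintype.card G.Edge *
      o.taitSum := by
  classical
  rw [slWeight, LieMetric.weight_eq_sum (slMetric 2) G o (fun x y => if x = y then 1 / 2 else 0)
    slPauli sum_slPauli, taitSum, Int.cast_sum, Finset.mul_sum]
  refine Finset.sum_congr rfl fun χ _ => ?_
  simp only [LieMetric.vertexProduct, slMetric_form_lie_slPauli, Finset.prod_ite_zero,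
    Finset.prod_mul_distrib, Finset.prod_const, Finset.card_univ]
  by_cases h : ∀ h, χ (G.opp h) = χ h
  · rw [if_pos h, if_pos fun e _ => (h _).symm]
    push_cast
    ring
  · rw [if_neg h, if_neg, Int.cast_zero, mul_zero, mul_zero]
    intro h1
    refine h fun k => ?_
    obtain ⟨e, rfl | rfl⟩ := exists_edge_of_halfEdge k
    · exact (h1 e (Finset.mem_univ _)).symm
    · rw [G.opp_opp]; exact h1 e (Finset.mem_univ _)

theorem slWeight_two_eq_zero_iff (o : G.CyclicOrder) : o.slWeight 2 = 0 ↔ o.taitSum = 0 := by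
  rw [slWeight_two]
  simp [Complex.I_ne_zero]

/-- Each reversed vertex changes one sign. Hence vanishing of the sum does not depend on the
orientation, which may be replaced by that of an embedding. -/
theorem taitSum_flip (o : G.CyclicOrder) (S : Finset G.Vertex) :
    (o.flip S).taitSum = (-1) ^ S.card * o.taitSum := by
  classical
  rw [taitSum, taitSum, Finset.mul_sum]
  refine Finset.sum_congr rfl fun χ _ => ?_
  rw [mul_ite, mul_zero]
  refine if_congr Iff.rfl ?_ rfl
  have h1 : (-1 : ℤ) ^ S.card = ∏ v, if v ∈ S then -1 else 1 := by
    rw [Finset.prod_ite_mem, Finset.univ_inter, Finset.prod_const]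
  rw [h1, ← Finset.prod_mul_distrib]
  refine Finset.prod_congr rfl fun v _ => ?_
  have hv := vertexOf_halfAt v
  split_ifs with h
  · rw [flip_next_of_mem _ (by rwa [hv]), flip_next_of_mem _ (by simpa [vertexOf_next, hv]),
      o.next_next_next, Color.sign_reverse]
    ring
  · rw [flip_next_of_notMem _ (by rwa [hv]), flip_next_of_notMem _ (by simpa [vertexOf_next, hv]),
      one_mul]

theorem isTait_iff (o : G.CyclicOrder) (χ : G.HalfEdge → Color) :
    o.IsTait χ ↔ (∀ h, χ (G.opp h) = χ h) ∧ ∏ v, Color.sign (χ (G.halfAt v))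
      (χ (o.next (G.halfAt v))) (χ (o.next (o.next (G.halfAt v)))) ≠ 0 := by
  rw [Finset.prod_ne_zero_iff]
  constructor
  · exact fun h => ⟨h.opp, fun v _ => h.sign_ne_zero _⟩
  · refine fun h => ⟨h.1, fun k => ?_⟩
    have h1 := h.2 (G.vertexOf k) (Finset.mem_univ _)
    rcases (o.vertexOf_eq_iff _ k).1 (vertexOf_halfAt (G.vertexOf k)).symm with h4 | h4 | h4 <;>
      rw [h4]
    · exact h1
    · rwa [o.next_next_next, Color.sign_rotate]
    · rwa [o.next_next_next, ← Color.sign_rotate]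

theorem exists_isTait_of_taitSum_ne_zero {o : G.CyclicOrder} (h : o.taitSum ≠ 0) :
    ∃ χ, o.IsTait χ := by
  obtain ⟨χ, -, hχ⟩ := Finset.exists_ne_zero_of_sum_ne_zero h
  refine ⟨χ, (o.isTait_iff χ).2 ?_⟩
  split_ifs at hχ with h1
  · exact ⟨h1, hχ⟩
  · exact absurd rfl hχ

/-- On the sphere all edge colorings have the same sign. -/
theorem IsSpherical.taitSum_ne_zero {o : G.CyclicOrder} (ho : o.IsSpherical)
    {χ : G.HalfEdge → Color} (hχ : o.IsTait χ) : o.taitSum ≠ 0 := by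
  classical
  have h1 : o.taitSum = ∑ χ : G.HalfEdge → Color,
      (-1) ^ (Fintype.card G.Vertex / 2) * (if o.IsTait χ then 1 else 0 : ℤ) := by
    refine Finset.sum_congr rfl fun χ' _ => ?_
    by_cases h2 : o.IsTait χ'
    · rw [if_pos h2, if_pos h2.opp, ho.prod_sign_eq h2, mul_one]
    · rw [if_neg h2, mul_zero]
      by_contra h3
      refine h2 ((o.isTait_iff χ').2 ?_)
      split_ifs at h3 with h4
      · exact ⟨h4, h3⟩
      · exact absurd rfl h3
  rw [h1, ← Finset.mul_sum]
  refine mul_ne_zero (pow_ne_zero _ (by norm_num)) (ne_of_gt ?_)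
  refine Finset.sum_pos' (fun _ _ => by split_ifs <;> norm_num) ⟨χ, Finset.mem_univ _, ?_⟩
  simp [hχ]

end CyclicOrder

end TrivalentGraph

/-! ### The equivalence. -/

theorem mainTheorem1 :
    -- `W_{sl(N)}(G)` is a polynomial in `N` of degree at most `v / 2 + 2`, so `slTop` makes sense
    (∀ (G : TrivalentGraph) (o : G.CyclicOrder), G.Connected →
      ∃ P : Polynomial ℂ, P.natDegree ≤ Fintype.card G.Vertex / 2 + 2 ∧ o.IsSlPolynomial P) ∧
    -- the statement about `sl(2)` and `sl(N)` is equivalent to the Four Color Theorem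
    ((∀ (G : TrivalentGraph) (o : G.CyclicOrder), G.Connected →
        o.slWeight 2 = 0 → o.slTop = 0) ↔
      (∀ G : TrivalentGraph, G.TwoConnected →
        ∀ o : G.CyclicOrder, o.IsSpherical → o.mapGraph.Colorable 4)) := by
  classical
  refine ⟨fun G o hG => ⟨o.facePolynomial, o.natDegree_facePolynomial_le hG,
    fun N _ => o.eval_facePolynomial N⟩, fun H G hG o ho => ?_, fun H G o hG hW => ?_⟩
  · have h1 : o.slTop ≠ 0 := by
      rw [o.slTop_eq]
      exact CyclicOrder.coeff_facePolynomial_ne_zero ho hG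
    have h2 : o.taitSum ≠ 0 := fun h2 =>
      h1 (H G o hG.1 ((o.slWeight_two_eq_zero_iff).2 h2))
    obtain ⟨χ, hχ⟩ := CyclicOrder.exists_isTait_of_taitSum_ne_zero h2
    exact ho.colorable_of_isTait hχ
  · rw [o.slTop_eq]
    by_cases h2 : G.TwoConnected
    · rw [o.coeff_facePolynomial hG]
      -- A spherical `o.flip S` would be four-colorable, hence have a nonzero Tait sum, which agrees
      -- with that of `o` up to sign.
      refine Finset.sum_eq_zero fun S _ => if_neg fun hS => ?_
      obtain ⟨χ, hχ⟩ := CyclicOrder.exists_isTait_of_colorable (H G h2 _ hS) (hS.faceOf_opp_ne h2)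
      refine hS.taitSum_ne_zero hχ ?_
      rw [o.taitSum_flip, o.slWeight_two_eq_zero_iff.1 hW, mul_zero]
    · rw [o.facePolynomial_eq_zero hG h2, Polynomial.coeff_zero]
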